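/- Let $p$ and $q$ be prime numbers with $p \mid q-1$, let $r\in(\mathbb Z/q)^\times$ be an element of order $p$, and let $$G=\big\langle\sigma,\tau,a,b:\ \sigma^p=\tau^p=1,\ a^q=b^q=1,\ \sigma a\sigma^{-1}=a^r,\ \tau b\tau^{-1}=b^r,\ [\sigma,b]=[\tau,a]=[a,b]=[\sigma,\tau]=1\big\rangle,$$ so that $G=\langle\sigma,a\rangle\times\langle\tau,b\rangle\cong(\mathbb Z_q\times\mathbb Z_q)\rtimes(\mathbb Z_p\times\mathbb Z_p)$. Let $\zeta\in\mathbb C$ be a primitive $p$-th root of unity and $K=\mathbb Q(\zeta)$. The element $$J=\frac1p\sum_{u,v=0}^{p-1}\zeta^{-uv}\,\tau^u\otimes\sigma^v\in KG\otimes_K KG$$ is a twist for the group algebra $KG$, i.e. it is invertible, $(1\otimes J)(\mathrm{id}\otimes\Delta)(J)=(J\otimes1)(\Delta\otimes\mathrm{id})(J)$ and $(\varepsilon\otimes\mathrm{id})(J)=(\mathrm{id}\otimes\varepsilon)(J)=1$. Let $\mathcal B_{p,q}(\zeta)=(KG)_J$ be the twisted Hopf algebra: it is $KG$ as an algebra,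 with the same counit, with comultiplication $\Delta_J(h)=J\Delta(h)J^{-1}$ and antipode $S_J(h)=U_JS(h)U_J^{-1}$, where $U_J=\sum J^{(1)}S(J^{(2)})$. For a finite-dimensional Hopf algebra $H$ over a field $F$ and a subring $R\subseteq F$, a Hopf order of $H$ over $R$ is a finitely generated projective $R$-submodule $X\subseteq H$ such that the natural map $X\otimes_RF\to H$ is an isomorphism, $1\in X$, $XX\subseteq X$, $\Delta(X)\subseteq X\otimes_RX$ (viewed inside $H\otimes_F H$), $\varepsilon(X)\subseteq R$ and $S(X)\subseteq X$. Then the complex Hopf algebra $\mathcal B_{p,q}(\zeta)\otimes_{\mathbb Q(\zeta)}\mathbb C$ is semisimple, and it does not admit a Hopf order over any number ring: for every number field $L$ and every embedding $L\hookrightarrow\mathbb C$, it has no Hopf order over the ring of integers $\mathcal O_L\subset\mathbb C$. -/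

import Mathlib

open scoped TensorProduct IntermediateField

namespace HopfTwist

open Coalgebra Bialgebra HopfAlgebra

section Aux

variable (K : Type*) {H : Type*} [Field K] [Ring H] [HopfAlgebra K H]

/-- `a ⊗ b ↦ (y ↦ a * y * S b)`, an algebra homomorphism `H ⊗ H → End H`. -/
noncomputable def sandwichL : H ⊗[K] H →ₐ[K] Module.End K H :=
  AlgHom.ofLinearMap
    (TensorProduct.lift
      ((LinearMap.mul K (Module.End K H)).compl₁₂ (LinearMap.mul K H)
        ((LinearMap.mul K H).flip ∘ₗ antipode K)))
    (by ext y; simp [Algebra.TensorProduct.one_def])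
    (by
      intro x x'
      induction x with
      | zero => simp
      | add a b ha hb => simp only [add_mul, map_add, ha, hb]
      | tmul a b =>
        induction x' with
        | zero => simp
        | add a b ha hb => simp only [mul_add, map_add, ha, hb]
        | tmul c d =>
          ext y
          simp [antipode_mul_antidistrib, mul_assoc])

@[simp]
lemma sandwichL_tmul (a b y : H) :
    sandwichL K (a ⊗ₜ[K] b) y = a * (y * antipode K b) := by
  simp [sandwichL]

/-- `a ⊗ b ↦ (y ↦ S a * y * b)`. -/
noncomputable def sandwichR : H ⊗[K] H →ₗ[K] Module.End K H :=
  TensorProduct.lift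
      ((LinearMap.mul K (Module.End K H)).compl₁₂ (LinearMap.mul K H ∘ₗ antipode K)
        (LinearMap.mul K H).flip)

@[simp]
lemma sandwichR_tmul (a b y : H) :
    sandwichR K (a ⊗ₜ[K] b) y = antipode K a * (y * b) := by
  simp [sandwichR]

lemma sandwichR_one : sandwichR K (1 : H ⊗[K] H) = 1 := by
  ext y; simp [Algebra.TensorProduct.one_def]

lemma sandwichR_mul (x x' : H ⊗[K] H) :
    sandwichR K (x * x') = sandwichR K x' * sandwichR K x := by
  induction x with
  | zero => simp
  | add a b ha hb => simp only [add_mul, mul_add, map_add, ha, hb]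
  | tmul a b =>
    induction x' with
    | zero => simp
    | add a b ha hb => simp only [add_mul, mul_add, map_add, ha, hb]
    | tmul c d =>
      ext y
      simp [antipode_mul_antidistrib, mul_assoc]

lemma sandwichL_comul (h : H) : sandwichL K (comul h) 1 = algebraMap K H (counit h) := by
  rw [← mul_antipode_lTensor_comul_apply]
  generalize comul (R := K) h = x
  induction x with
  | zero => simp
  | add a b ha hb => simp only [map_add, LinearMap.add_apply, ha, hb]
  | tmul a b => simp

lemma sandwichR_comul (h : H) : sandwichR K (comul h) 1 = algebraMap K H (counit h) := by
  rw [← mul_antipode_rTensor_comul_apply]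
  generalize comul (R := K) h = x
  induction x with
  | zero => simp
  | add a b ha hb => simp only [map_add, LinearMap.add_apply, ha, hb]
  | tmul a b => simp

/-- `a ⊗ (b ⊗ c) ↦ a * S b * c`. -/
noncomputable def contract : H ⊗[K] (H ⊗[K] H) →ₗ[K] H :=
  LinearMap.mul' K H ∘ₗ
    (LinearMap.mul' K H ∘ₗ (antipode K).rTensor H).lTensor H

@[simp]
lemma contract_tmul (a b c : H) :
    contract K (a ⊗ₜ[K] (b ⊗ₜ[K] c)) = a * (antipode K b * c) := by
  simp [contract]

end Aux

end HopfTwist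

open HopfTwist Coalgebra Bialgebra HopfAlgebra in
/-- A (Drinfel'd) twist for a Hopf algebra `H` over a field `K`: an invertible element `J` of
`H ⊗ H` with `(1 ⊗ J) (id ⊗ Δ)(J) = (J ⊗ 1) (Δ ⊗ id)(J)` (in `H ⊗ (H ⊗ H)`) and
`(ε ⊗ id)(J) = 1 = (id ⊗ ε)(J)`. -/
structure HopfTwist (K H : Type*) [Field K] [Ring H] [HopfAlgebra K H] where
  J : (H ⊗[K] H)ˣ
  cocycle :
    ((1 : H) ⊗ₜ[K] (J : H ⊗[K] H)) *
        Algebra.TensorProduct.map (AlgHom.id K H) (comulAlgHom K H) (J : H ⊗[K] H) =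
      Algebra.TensorProduct.assoc K K K H H H ((J : H ⊗[K] H) ⊗ₜ[K] (1 : H)) *
        Algebra.TensorProduct.assoc K K K H H H
          (Algebra.TensorProduct.map (comulAlgHom K H) (AlgHom.id K H) (J : H ⊗[K] H))
  counit_left :
    Algebra.TensorProduct.lid K H
      (Algebra.TensorProduct.map (counitAlgHom K H) (AlgHom.id K H) (J : H ⊗[K] H)) = 1
  counit_right :
    Algebra.TensorProduct.rid K K H
      (Algebra.TensorProduct.map (AlgHom.id K H) (counitAlgHom K H) (J : H ⊗[K] H)) = 1

namespace HopfTwist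

open Coalgebra Bialgebra HopfAlgebra

variable {K H : Type*} [Field K] [Ring H] [HopfAlgebra K H] (T : HopfTwist K H)

/-- The twisted comultiplication `Δ_J(h) = J Δ(h) J⁻¹`. -/
noncomputable def comulTwist : H →ₐ[K] H ⊗[K] H :=
  AlgHom.ofLinearMap
    (LinearMap.mulLeftRight K ((T.J : H ⊗[K] H), ((T.J⁻¹ : (H ⊗[K] H)ˣ) : H ⊗[K] H)) ∘ₗ comul)
    (by simp)
    (by
      intro x y
      simp only [LinearMap.comp_apply, LinearMap.mulLeftRight_apply, comul_mul]
      simp only [mul_assoc, Units.inv_mul_cancel_left])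

lemma comulTwist_apply (h : H) :
    T.comulTwist h = (T.J : H ⊗[K] H) * comul h * ((T.J⁻¹ : (H ⊗[K] H)ˣ) : H ⊗[K] H) := by
  simp [comulTwist]

/-- `U_J = ∑ J⁽¹⁾ S(J⁽²⁾)`. -/
noncomputable def U : H :=
  LinearMap.mul' K H ((antipode K).lTensor H (T.J : H ⊗[K] H))

/-- `U_J⁻¹ = ∑ S(J⁻⁽¹⁾) J⁻⁽²⁾`. -/
noncomputable def Uinv : H :=
  LinearMap.mul' K H ((antipode K).rTensor H ((T.J⁻¹ : (H ⊗[K] H)ˣ) : H ⊗[K] H))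

/-- The twisted antipode `S_J(h) = U_J S(h) U_J⁻¹`. -/
noncomputable def antipodeTwist : H →ₗ[K] H :=
  LinearMap.mulLeftRight K (T.U, T.Uinv) ∘ₗ antipode K

lemma antipodeTwist_apply (h : H) : T.antipodeTwist h = T.U * antipode K h * T.Uinv := by
  simp [antipodeTwist]

lemma U_eq : T.U = sandwichL K (T.J : H ⊗[K] H) 1 := by
  unfold U
  generalize (T.J : H ⊗[K] H) = x
  induction x with
  | zero => simp
  | add a b ha hb => simp only [map_add, LinearMap.add_apply, ha, hb]
  | tmul a b => simp

lemma Uinv_eq : T.Uinv = sandwichR K ((T.J⁻¹ : (H ⊗[K] H)ˣ) : H ⊗[K] H) 1 := by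
  unfold Uinv
  generalize ((T.J⁻¹ : (H ⊗[K] H)ˣ) : H ⊗[K] H) = x
  induction x with
  | zero => simp
  | add a b ha hb => simp only [map_add, LinearMap.add_apply, ha, hb]
  | tmul a b => simp

lemma counit_left_inv :
    Algebra.TensorProduct.lid K H (Algebra.TensorProduct.map (counitAlgHom K H) (AlgHom.id K H)
      ((T.J⁻¹ : (H ⊗[K] H)ˣ) : H ⊗[K] H)) = 1 := by
  have h : Algebra.TensorProduct.lid K H (Algebra.TensorProduct.map (counitAlgHom K H)
      (AlgHom.id K H) ((T.J : H ⊗[K] H) * ((T.J⁻¹ : (H ⊗[K] H)ˣ) : H ⊗[K] H))) = 1 := by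
    rw [Units.mul_inv]; simp only [map_one]
  rwa [map_mul, map_mul, T.counit_left, one_mul] at h

lemma counit_right_inv :
    Algebra.TensorProduct.rid K K H (Algebra.TensorProduct.map (AlgHom.id K H) (counitAlgHom K H)
      ((T.J⁻¹ : (H ⊗[K] H)ˣ) : H ⊗[K] H)) = 1 := by
  have h : Algebra.TensorProduct.rid K K H (Algebra.TensorProduct.map (AlgHom.id K H)
      (counitAlgHom K H) ((T.J : H ⊗[K] H) * ((T.J⁻¹ : (H ⊗[K] H)ˣ) : H ⊗[K] H))) = 1 := by
    rw [Units.mul_inv]; simp only [map_one]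
  rwa [map_mul, map_mul, T.counit_right, one_mul] at h

lemma contract_aux₁ (x y : H ⊗[K] H) :
    contract K (((1 : H) ⊗ₜ[K] x) * Algebra.TensorProduct.assoc K K K H H H (y ⊗ₜ[K] (1 : H))) =
      sandwichL K y 1 * sandwichR K x 1 := by
  induction x with
  | zero => simp
  | add a b ha hb =>
    simp only [TensorProduct.tmul_add, add_mul, mul_add, map_add, ha, hb, LinearMap.add_apply]
  | tmul a b =>
    induction y with
    | zero => simp
    | add a b ha hb =>
      simp only [TensorProduct.add_tmul, add_mul, mul_add, map_add, ha, hb, LinearMap.add_apply]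
    | tmul c d => simp [antipode_mul_antidistrib, mul_assoc]

lemma contract_aux₂ (a b : H) (y z : H ⊗[K] H) :
    contract K ((a ⊗ₜ[K] y) * Algebra.TensorProduct.assoc K K K H H H (z ⊗ₜ[K] b)) =
      a * sandwichL K z 1 * (sandwichR K y 1 * b) := by
  induction y with
  | zero => simp
  | add c d hc hd =>
    simp only [TensorProduct.tmul_add, add_mul, mul_add, map_add, hc, hd, LinearMap.add_apply]
  | tmul e f =>
    induction z with
    | zero => simp
    | add c d hc hd =>
      simp only [TensorProduct.add_tmul, add_mul, mul_add, map_add, hc, hd, LinearMap.add_apply]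
    | tmul c d => simp [antipode_mul_antidistrib, mul_assoc]

lemma contract_aux₃ (x y : H ⊗[K] H) :
    contract K (Algebra.TensorProduct.map (AlgHom.id K H) (comulAlgHom K H) x *
      Algebra.TensorProduct.assoc K K K H H H
          (Algebra.TensorProduct.map (comulAlgHom K H) (AlgHom.id K H) y)) =
      Algebra.TensorProduct.rid K K H
        (Algebra.TensorProduct.map (AlgHom.id K H) (counitAlgHom K H) x) *
      Algebra.TensorProduct.lid K H
        (Algebra.TensorProduct.map (counitAlgHom K H) (AlgHom.id K H) y) := by
  induction x with
  | zero => simp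
  | add a b ha hb => simp only [add_mul, map_add, ha, hb]
  | tmul a b =>
    induction y with
    | zero => simp
    | add a b ha hb => simp only [mul_add, map_add, ha, hb]
    | tmul c d =>
      simp only [Algebra.TensorProduct.map_tmul, AlgHom.id_apply, comulAlgHom_apply,
        contract_aux₂, sandwichL_comul, sandwichR_comul]
      simp only [counitAlgHom_apply, Algebra.TensorProduct.rid_tmul,
        Algebra.TensorProduct.lid_tmul, Algebra.smul_def]
      rw [Algebra.commutes (counit (R := K) b) a]
      simp only [mul_assoc]
      rw [← mul_assoc (algebraMap K H _) (algebraMap K H _) d, ← map_mul, mul_comm, map_mul, mul_assoc]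

lemma U_mul_Uinv : T.U * T.Uinv = 1 := by
  rw [U_eq, Uinv_eq, ← contract_aux₁]
  set J : H ⊗[K] H := (T.J : H ⊗[K] H) with hJ
  set I : H ⊗[K] H := ((T.J⁻¹ : (H ⊗[K] H)ˣ) : H ⊗[K] H) with hI
  have hIJ : I * J = 1 := by rw [hI, hJ, Units.inv_mul]
  have hJI : J * I = 1 := by rw [hI, hJ, Units.mul_inv]
  set φ := (Algebra.TensorProduct.assoc K K K H H H).toAlgHom.comp
    (Algebra.TensorProduct.map (comulAlgHom K H) (AlgHom.id K H)) with hφ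
  have hc : ((1 : H) ⊗ₜ[K] J) *
        Algebra.TensorProduct.map (AlgHom.id K H) (comulAlgHom K H) J =
      Algebra.TensorProduct.assoc K K K H H H (J ⊗ₜ[K] (1 : H)) * φ J := T.cocycle
  have h1 : ((1 : H) ⊗ₜ[K] I) * ((1 : H) ⊗ₜ[K] J) = 1 := by
    simp [hIJ, Algebra.TensorProduct.one_def]
  have h2 : φ J * φ I = 1 := by rw [← map_mul, hJI, map_one]
  have key : ((1 : H) ⊗ₜ[K] I) * Algebra.TensorProduct.assoc K K K H H H (J ⊗ₜ[K] (1 : H)) =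
      Algebra.TensorProduct.map (AlgHom.id K H) (comulAlgHom K H) J * φ I := by
    calc _ = ((1 : H) ⊗ₜ[K] I) *
          (Algebra.TensorProduct.assoc K K K H H H (J ⊗ₜ[K] (1 : H)) * φ J) * φ I := by
            rw [mul_assoc, mul_assoc, h2, mul_one]
      _ = _ := by rw [← hc, ← mul_assoc, h1, one_mul]
  rw [key, hφ]
  refine (contract_aux₃ _ _).trans ?_
  rw [T.counit_right, T.counit_left_inv, one_mul]

lemma coassoc_twist (h : H) :
    TensorProduct.assoc K H H H (T.comulTwist.toLinearMap.rTensor H (T.comulTwist h)) =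
      T.comulTwist.toLinearMap.lTensor H (T.comulTwist h) := by
  set J : H ⊗[K] H := (T.J : H ⊗[K] H) with hJ
  set I : H ⊗[K] H := ((T.J⁻¹ : (H ⊗[K] H)ˣ) : H ⊗[K] H) with hI
  have hIJ : I * J = 1 := by rw [hI, hJ, Units.inv_mul]
  have hJI : J * I = 1 := by rw [hI, hJ, Units.mul_inv]
  have happ : ∀ h : H, T.comulTwist h = J * comul h * I := T.comulTwist_apply
  set α := Algebra.TensorProduct.assoc K K K H H H with hα
  set φ := α.toAlgHom.comp
    (Algebra.TensorProduct.map (comulAlgHom K H) (AlgHom.id K H)) with hφ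
  set ψ := Algebra.TensorProduct.map (AlgHom.id K H) (comulAlgHom K H) with hψ
  have hc : ((1 : H) ⊗ₜ[K] J) * ψ J = α (J ⊗ₜ[K] (1 : H)) * φ J := T.cocycle
  have hL : ∀ x : H ⊗[K] H, TensorProduct.assoc K H H H (T.comulTwist.toLinearMap.rTensor H x) =
      α (J ⊗ₜ[K] (1 : H)) * φ x * α (I ⊗ₜ[K] (1 : H)) := by
    intro x
    induction x with
    | zero => simp
    | add a b ha hb => simp only [map_add, add_mul, mul_add, ha, hb]
    | tmul a b =>
      have : φ (a ⊗ₜ[K] b) = α (comul (R := K) a ⊗ₜ[K] b) := by simp [hφ]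
      rw [this, ← map_mul, ← map_mul]
      simp only [LinearMap.rTensor_tmul, AlgHom.toLinearMap_apply, happ,
        Algebra.TensorProduct.tmul_mul_tmul, one_mul, mul_one]
      rfl
  have hR : ∀ x : H ⊗[K] H, T.comulTwist.toLinearMap.lTensor H x =
      ((1 : H) ⊗ₜ[K] J) * ψ x * ((1 : H) ⊗ₜ[K] I) := by
    intro x
    induction x with
    | zero => simp
    | add a b ha hb => simp only [map_add, add_mul, mul_add, ha, hb]
    | tmul a b => simp [hψ, happ]
  have hco : φ (comul h) = ψ (comul h) := coassoc_apply (R := K) h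
  have hinv : φ I * α (I ⊗ₜ[K] (1 : H)) = ψ I * ((1 : H) ⊗ₜ[K] I) := by
    have e1 : (φ I * α (I ⊗ₜ[K] (1 : H))) * (α (J ⊗ₜ[K] (1 : H)) * φ J) = 1 := by
      rw [mul_assoc, ← mul_assoc (α _), ← map_mul α]
      simp only [Algebra.TensorProduct.tmul_mul_tmul, hIJ, mul_one]
      rw [← Algebra.TensorProduct.one_def, map_one, one_mul, ← map_mul, hIJ, map_one]
    have e2 : (((1 : H) ⊗ₜ[K] J) * ψ J) * (ψ I * ((1 : H) ⊗ₜ[K] I)) = 1 := by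
      rw [mul_assoc, ← mul_assoc (ψ J), ← map_mul ψ, hJI, map_one, one_mul]
      simp [hJI, Algebra.TensorProduct.one_def]
    rw [hc] at e2
    exact left_inv_eq_right_inv e1 e2
  rw [hL, hR, happ]
  simp only [map_mul, hco]
  calc _ = (α (J ⊗ₜ[K] (1 : H)) * φ J) * ψ (comul h) * (φ I * α (I ⊗ₜ[K] (1 : H))) := by
        simp only [mul_assoc]
    _ = _ := by rw [← hc, hinv]; simp only [mul_assoc]

lemma rTensor_counit_comulTwist (h : H) :
    (counit (R := K)).rTensor H (T.comulTwist h) = 1 ⊗ₜ[K] h := by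
  set ψ := (Algebra.TensorProduct.lid K H).toAlgHom.comp
    (Algebra.TensorProduct.map (counitAlgHom K H) (AlgHom.id K H)) with hψ
  have h0 : ψ (T.comulTwist h) = h := by
    rw [comulTwist_apply, map_mul, map_mul]
    have h1 : ψ (T.J : H ⊗[K] H) = 1 := T.counit_left
    have h2 : ψ ((T.J⁻¹ : (H ⊗[K] H)ˣ) : H ⊗[K] H) = 1 := T.counit_left_inv
    have h3 : ψ (comul h) = TensorProduct.lid K H ((counit (R := K)).rTensor H (comul h)) := rfl
    rw [h1, h2, h3]
    simp
  apply (TensorProduct.lid K H).injective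
  refine Eq.trans h0 ?_
  simp

lemma lTensor_counit_comulTwist (h : H) :
    (counit (R := K)).lTensor H (T.comulTwist h) = h ⊗ₜ[K] 1 := by
  set ψ := (Algebra.TensorProduct.rid K K H).toAlgHom.comp
    (Algebra.TensorProduct.map (AlgHom.id K H) (counitAlgHom K H)) with hψ
  have h0 : ψ (T.comulTwist h) = h := by
    rw [comulTwist_apply, map_mul, map_mul]
    have h1 : ψ (T.J : H ⊗[K] H) = 1 := T.counit_right
    have h2 : ψ ((T.J⁻¹ : (H ⊗[K] H)ˣ) : H ⊗[K] H) = 1 := T.counit_right_inv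
    have h3 : ψ (comul h) = TensorProduct.rid K H ((counit (R := K)).lTensor H (comul h)) := rfl
    rw [h1, h2, h3]
    simp
  apply (TensorProduct.rid K H).injective
  refine Eq.trans h0 ?_
  simp

lemma mul_antipodeTwist_rTensor (h : H) :
    LinearMap.mul' K H (T.antipodeTwist.rTensor H (T.comulTwist h)) =
      algebraMap K H (counit h) := by
  have hR : ∀ x : H ⊗[K] H, LinearMap.mul' K H (T.antipodeTwist.rTensor H x) =
      T.U * sandwichR K x T.Uinv := by
    intro x
    induction x with
    | zero => simp
    | add a b ha hb => simp only [map_add, mul_add, LinearMap.add_apply, ha, hb]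
    | tmul a b => simp [antipodeTwist_apply, mul_assoc]
  have h1 : sandwichR K (T.J : H ⊗[K] H) (T.Uinv) = 1 := by
    rw [Uinv_eq, ← Module.End.mul_apply, ← sandwichR_mul, Units.inv_mul, sandwichR_one]
    rfl
  rw [hR, comulTwist_apply, sandwichR_mul, sandwichR_mul, Module.End.mul_apply,
    Module.End.mul_apply, h1, sandwichR_comul, Algebra.algebraMap_eq_smul_one, map_smul,
    ← Uinv_eq, mul_smul_comm, U_mul_Uinv]

lemma mul_antipodeTwist_lTensor (h : H) :
    LinearMap.mul' K H (T.antipodeTwist.lTensor H (T.comulTwist h)) =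
      algebraMap K H (counit h) := by
  have hL : ∀ x : H ⊗[K] H, LinearMap.mul' K H (T.antipodeTwist.lTensor H x) =
      sandwichL K x T.U * T.Uinv := by
    intro x
    induction x with
    | zero => simp
    | add a b ha hb => simp only [map_add, add_mul, LinearMap.add_apply, ha, hb]
    | tmul a b => simp [antipodeTwist_apply, mul_assoc]
  have h1 : sandwichL K ((T.J⁻¹ : (H ⊗[K] H)ˣ) : H ⊗[K] H) T.U = 1 := by
    rw [U_eq, ← Module.End.mul_apply, ← map_mul (sandwichL K), Units.inv_mul, map_one (sandwichL K)]
    rfl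
  rw [hL, comulTwist_apply, map_mul (sandwichL K), map_mul (sandwichL K), Module.End.mul_apply,
    Module.End.mul_apply, h1, sandwichL_comul, Algebra.algebraMap_eq_smul_one, map_smul,
    ← U_eq, smul_mul_assoc, U_mul_Uinv]

/-- The Drinfel'd twist `H_J`: the algebra `H` (a type synonym) with the counit of `H`,
comultiplication `Δ_J` and antipode `S_J`. -/
def Twisted (_T : HopfTwist K H) : Type _ := H

noncomputable instance : Ring T.Twisted := inferInstanceAs (Ring H)

noncomputable instance : Algebra K T.Twisted := inferInstanceAs (Algebra K H)

noncomputable instance : Coalgebra K T.Twisted where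
  comul := (T.comulTwist.toLinearMap : H →ₗ[K] H ⊗[K] H)
  counit := (counit : H →ₗ[K] K)
  coassoc := LinearMap.ext fun h : H => T.coassoc_twist h
  rTensor_counit_comp_comul := LinearMap.ext fun h : H => T.rTensor_counit_comulTwist h
  lTensor_counit_comp_comul := LinearMap.ext fun h : H => T.lTensor_counit_comulTwist h

noncomputable instance : Bialgebra K T.Twisted :=
  Bialgebra.mk' K T.Twisted
    (counit_one (R := K) (A := H))
    (fun {a b} => counit_mul (R := K) (A := H) a b)
    (map_one T.comulTwist)
    (fun {a b} => map_mul T.comulTwist a b)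

noncomputable instance : HopfAlgebra K T.Twisted where
  antipode := T.antipodeTwist
  mul_antipode_rTensor_comul := LinearMap.ext fun h : H => T.mul_antipodeTwist_rTensor h
  mul_antipode_lTensor_comul := LinearMap.ext fun h : H => T.mul_antipodeTwist_lTensor h

end HopfTwist

namespace GalindoNatale

section Group

variable {p q : ℕ}

/-- The action of `ℤ_p` (generated by `σ`) on `ℤ_q` (generated by `a`, both written
multiplicatively) in which `σ` acts by `a ↦ a ^ r`, where `r ∈ ℤ_q^×` has order `p`. -/
def action [NeZero p] (r : (ZMod q)ˣ) (hr : orderOf r = p) :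
    Multiplicative (ZMod p) →* MulAut (Multiplicative (ZMod q)) where
  toFun i := AddEquiv.toMultiplicative
    (DistribMulAction.toAddEquiv (ZMod q) (r ^ (Multiplicative.toAdd i).val))
  map_one' := by
    ext x
    simp
  map_mul' i j := by
    ext x
    have h : r ^ (Multiplicative.toAdd i + Multiplicative.toAdd j).val =
        r ^ (Multiplicative.toAdd i).val * r ^ (Multiplicative.toAdd j).val := by
      rw [← pow_add, ZMod.val_add, pow_eq_pow_iff_modEq, hr]
      exact Nat.mod_modEq _ _
    simp [h, mul_smul]

/-- The semidirect product `ℤ_q ⋊ ℤ_p = ⟨σ, a : σ^p = a^q = 1, σ a σ⁻¹ = a^r⟩`. -/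
abbrev Factor [NeZero p] (r : (ZMod q)ˣ) (hr : orderOf r = p) : Type :=
  Multiplicative (ZMod q) ⋊[action r hr] Multiplicative (ZMod p)

/-- The group `G = G₁ × G₂ = (ℤ_q × ℤ_q) ⋊ (ℤ_p × ℤ_p)` with `G₁ = ⟨σ, a⟩ ≅ ℤ_q ⋊ ℤ_p` and
`G₂ = ⟨τ, b⟩ ≅ ℤ_q ⋊ ℤ_p`. -/
abbrev G [NeZero p] (r : (ZMod q)ˣ) (hr : orderOf r = p) : Type := Factor r hr × Factor r hr

variable [NeZero p] (r : (ZMod q)ˣ) (hr : orderOf r = p)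

/-- The generator `σ` of `G`. -/
def σ : G r hr := (SemidirectProduct.inr (Multiplicative.ofAdd 1), 1)

/-- The generator `τ` of `G`. -/
def τ : G r hr := (1, SemidirectProduct.inr (Multiplicative.ofAdd 1))

/-- The generator `a` of `G`. -/
def a : G r hr := (SemidirectProduct.inl (Multiplicative.ofAdd 1), 1)

/-- The generator `b` of `G`. -/
def b : G r hr := (1, SemidirectProduct.inl (Multiplicative.ofAdd 1))

lemma ofAdd_one_pow (n : ℕ) : (Multiplicative.ofAdd (1 : ZMod n)) ^ n = 1 := by
  rw [← ofAdd_nsmul]; simp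

lemma σ_pow : σ r hr ^ p = 1 := by
  ext1
  · simp only [σ, Prod.pow_fst, ← map_pow, ofAdd_one_pow, map_one, Prod.fst_one]
  · simp [σ]

lemma τ_pow : τ r hr ^ p = 1 := by
  ext1
  · simp [τ]
  · simp only [τ, Prod.pow_snd, ← map_pow, ofAdd_one_pow, map_one, Prod.snd_one]

lemma commute_σ_τ : Commute (σ r hr) (τ r hr) := by
  simp [Commute, SemiconjBy, σ, τ]

end Group

section Algebra

open Coalgebra Bialgebra HopfAlgebra

variable {K A : Type*} [Field K] [Ring A]

/-- `(1/p) ∑_u c^{-nu} x^u`; for `x ^ p = 1` this is the idempotent on which `x` acts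
by `c ^ n`. -/
noncomputable def idem [Algebra K A] (p : ℕ) (c : K) (x : A) (n : ℕ) : A :=
  (p : K)⁻¹ • ∑ u ∈ Finset.range p, c⁻¹ ^ (u * n) • x ^ u

/-- `(1/p) ∑_{u,v} c^{-uv} x^u ⊗ y^v`, the sum over `0 ≤ u, v ≤ p - 1`. -/
noncomputable def twistElt [Algebra K A] (p : ℕ) (c : K) (x y : A) : A ⊗[K] A :=
  (p : K)⁻¹ • ∑ u ∈ Finset.range p, ∑ v ∈ Finset.range p,
    c⁻¹ ^ (u * v) • ((x ^ u) ⊗ₜ[K] (y ^ v))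

section

variable [Algebra K A] {p : ℕ}

lemma mul_idem {c : K} (hc : c ^ p = 1) (hp : p ≠ 0) {x : A} (hx : x ^ p = 1) (n : ℕ) :
    x * idem p c x n = c ^ n • idem p c x n := by
  have hc0 : c ≠ 0 := by
    rintro rfl
    simp [hp] at hc
  have key : ∑ u ∈ Finset.range p, c⁻¹ ^ ((u + 1) * n) • x ^ (u + 1) =
      ∑ u ∈ Finset.range p, c⁻¹ ^ (u * n) • x ^ u := by
    have h1 := Finset.sum_range_succ (fun u => c⁻¹ ^ (u * n) • x ^ u) p
    have h2 := Finset.sum_range_succ' (fun u => c⁻¹ ^ (u * n) • x ^ u) p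
    rw [h1] at h2
    have h3 : c⁻¹ ^ (p * n) • x ^ p = c⁻¹ ^ (0 * n) • x ^ 0 := by
      rw [pow_mul, inv_pow, hc, hx]; simp
    rw [h3] at h2
    exact (add_right_cancel h2).symm
  unfold idem
  rw [mul_smul_comm, smul_comm (c ^ n), ← key, Finset.smul_sum, key, Finset.mul_sum]
  congr 1
  refine Finset.sum_congr rfl fun u _ => ?_
  rw [mul_smul_comm, smul_smul, ← pow_succ', add_mul, one_mul, pow_add _ (u * n), mul_left_comm,
    ← mul_pow, mul_inv_cancel₀ hc0, one_pow, mul_one]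

lemma pow_mul_idem {c : K} (hc : c ^ p = 1) (hp : p ≠ 0) {x : A} (hx : x ^ p = 1) (m n : ℕ) :
    x ^ m * idem p c x n = c ^ (m * n) • idem p c x n := by
  induction m with
  | zero => simp
  | succ m ih =>
    rw [pow_succ, mul_assoc, mul_idem hc hp hx, mul_smul_comm, ih, smul_smul, ← pow_add]
    congr 2
    ring

lemma idem_mul_pow {c : K} (hc : c ^ p = 1) (hp : p ≠ 0) {x : A} (hx : x ^ p = 1) (m n : ℕ) :
    idem p c x n * x ^ m = c ^ (m * n) • idem p c x n := by
  rw [← pow_mul_idem hc hp hx]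
  unfold idem
  rw [mul_smul_comm, smul_mul_assoc, Finset.sum_mul, Finset.mul_sum]
  congr 1
  refine Finset.sum_congr rfl fun u _ => ?_
  rw [mul_smul_comm, smul_mul_assoc, ← pow_add, ← pow_add, add_comm]

lemma sum_idem {c : K} (hc : IsPrimitiveRoot c p) (hp : p ≠ 0) (x : A) :
    ∑ n ∈ Finset.range p, idem p c x n = 1 := by
  have : NeZero p := ⟨hp⟩
  have hpK : (p : K) ≠ 0 := (hc.neZero').out
  unfold idem
  rw [← Finset.smul_sum, Finset.sum_comm]
  have h : ∀ u ∈ Finset.range p, ∑ n ∈ Finset.range p, c⁻¹ ^ (u * n) • x ^ u =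
      if u = 0 then (p : K) • (1 : A) else 0 := by
    intro u hu
    rw [← Finset.sum_smul]
    split_ifs with h0
    · simp [h0]
    · have h1 : c⁻¹ ^ u ≠ 1 := hc.inv.pow_ne_one_of_pos_of_lt h0 (Finset.mem_range.mp hu)
      have h2 := mul_geom_sum (c⁻¹ ^ u) p
      rw [← pow_mul, mul_comm u p, pow_mul, hc.inv.pow_eq_one, one_pow, sub_self] at h2
      have h3 := (mul_eq_zero.mp h2).resolve_left (sub_ne_zero.mpr h1)
      simp only [pow_mul, h3, zero_smul]
  rw [Finset.sum_congr rfl h, Finset.sum_ite_eq' , if_pos (Finset.mem_range.mpr (by omega)),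
    smul_smul, inv_mul_cancel₀ hpK, one_smul]

lemma twistElt_eq_left (c : K) (x y : A) :
    twistElt p c x y = ∑ u ∈ Finset.range p, (x ^ u) ⊗ₜ[K] idem p c y u := by
  unfold twistElt idem
  simp only [TensorProduct.tmul_smul, TensorProduct.tmul_sum, Finset.smul_sum, mul_comm]

lemma twistElt_eq_right (c : K) (x y : A) :
    twistElt p c x y = ∑ v ∈ Finset.range p, idem p c x v ⊗ₜ[K] (y ^ v) := by
  unfold twistElt idem
  rw [Finset.sum_comm]
  simp only [TensorProduct.smul_tmul', TensorProduct.sum_tmul, Finset.smul_sum]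

lemma twistElt_mul_inv {c : K} (hc : IsPrimitiveRoot c p) (hp : p ≠ 0) {x y : A}
    (hx : x ^ p = 1) (hy : y ^ p = 1) :
    twistElt p c x y * twistElt p c⁻¹ x y = 1 := by
  have hc0 : c ≠ 0 := hc.ne_zero hp
  rw [twistElt_eq_right, twistElt_eq_left, Finset.sum_mul]
  simp only [Finset.mul_sum, Algebra.TensorProduct.tmul_mul_tmul,
    idem_mul_pow hc.pow_eq_one hp hx, pow_mul_idem hc.inv.pow_eq_one hp hy]
  have : ∀ u v : ℕ, (c ^ (v * u) • idem p c x u) ⊗ₜ[K] (c⁻¹ ^ (u * v) • idem p c⁻¹ y v) =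
      idem p c x u ⊗ₜ[K] idem p c⁻¹ y v := by
    intro u v
    rw [TensorProduct.smul_tmul_smul, mul_comm v u, ← mul_pow, mul_inv_cancel₀ hc0, one_pow,
      one_smul]
  simp only [this, ← TensorProduct.tmul_sum, ← TensorProduct.sum_tmul]
  rw [sum_idem hc hp, sum_idem hc.inv hp, Algebra.TensorProduct.one_def]

/-- The unit `J = (1/p) ∑_{u,v} c^{-uv} x^u ⊗ y^v`, with inverse
`(1/p) ∑_{u,v} c^{uv} x^u ⊗ y^v`. -/
noncomputable def twistUnit {c : K} (hc : IsPrimitiveRoot c p) (hp : p ≠ 0) {x y : A}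
    (hx : x ^ p = 1) (hy : y ^ p = 1) : (A ⊗[K] A)ˣ where
  val := twistElt p c x y
  inv := twistElt p c⁻¹ x y
  val_inv := twistElt_mul_inv hc hp hx hy
  inv_val := by
    have h := twistElt_mul_inv hc.inv hp hx hy
    rwa [inv_inv] at h

end

/-- The twist `J = (1/p) ∑_{u,v} c^{-uv} x^u ⊗ y^v` of a Hopf algebra attached to commuting
group-like elements `x, y` with `x^p = y^p = 1` and a primitive `p`-th root of unity `c`. -/
noncomputable def twist [HopfAlgebra K A] {p : ℕ} {c : K} (hc : IsPrimitiveRoot c p)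
    (hp : p ≠ 0) {x y : A} (hx : x ^ p = 1) (hy : y ^ p = 1) (hxy : Commute x y)
    (gx : IsGroupLikeElem K x) (gy : IsGroupLikeElem K y) : HopfTwist K A where
  J := twistUnit hc hp hx hy
  cocycle := by
    have hl : ((twistUnit hc hp hx hy : (A ⊗[K] A)ˣ) : A ⊗[K] A) =
      ∑ u ∈ Finset.range p, (x ^ u) ⊗ₜ[K] idem p c y u := twistElt_eq_left c x y
    have hr : ((twistUnit hc hp hx hy : (A ⊗[K] A)ˣ) : A ⊗[K] A) =
      ∑ v ∈ Finset.range p, idem p c x v ⊗ₜ[K] (y ^ v) := twistElt_eq_right c x y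
    have e1 : Algebra.TensorProduct.map (AlgHom.id K A) (comulAlgHom K A)
        ((twistUnit hc hp hx hy : (A ⊗[K] A)ˣ) : A ⊗[K] A) =
        ∑ v ∈ Finset.range p, idem p c x v ⊗ₜ[K] ((y ^ v) ⊗ₜ[K] (y ^ v)) := by
      rw [hr, map_sum]
      refine Finset.sum_congr rfl fun v _ => ?_
      simp [gy.comul_eq_tmul_self, Algebra.TensorProduct.tmul_pow]
    have e2 : Algebra.TensorProduct.map (comulAlgHom K A) (AlgHom.id K A)
        ((twistUnit hc hp hx hy : (A ⊗[K] A)ˣ) : A ⊗[K] A) =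
        ∑ u ∈ Finset.range p, ((x ^ u) ⊗ₜ[K] (x ^ u)) ⊗ₜ[K] idem p c y u := by
      rw [hl, map_sum]
      refine Finset.sum_congr rfl fun v _ => ?_
      simp [gx.comul_eq_tmul_self, Algebra.TensorProduct.tmul_pow]
    rw [e1, e2]
    conv_lhs => rw [hl]
    conv_rhs => rw [hr]
    simp only [TensorProduct.sum_tmul, TensorProduct.tmul_sum, map_sum, Finset.sum_mul,
      Finset.mul_sum, Algebra.TensorProduct.assoc_tmul, Algebra.TensorProduct.tmul_mul_tmul,
      one_mul, idem_mul_pow hc.pow_eq_one hp hx, idem_mul_pow hc.pow_eq_one hp hy]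
    rw [Finset.sum_comm]
    refine Finset.sum_congr rfl fun v _ => Finset.sum_congr rfl fun u _ => ?_
    rw [(hxy.pow_pow v u).eq]
    simp only [← TensorProduct.smul_tmul', TensorProduct.tmul_smul, mul_comm v u]
  counit_left := by
    have hl : ((twistUnit hc hp hx hy : (A ⊗[K] A)ˣ) : A ⊗[K] A) =
      ∑ u ∈ Finset.range p, (x ^ u) ⊗ₜ[K] idem p c y u := twistElt_eq_left c x y
    rw [hl, map_sum, map_sum, ← sum_idem hc hp y]
    refine Finset.sum_congr rfl fun v _ => ?_
    simp [gx.counit_eq_one]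
  counit_right := by
    have hr : ((twistUnit hc hp hx hy : (A ⊗[K] A)ˣ) : A ⊗[K] A) =
      ∑ v ∈ Finset.range p, idem p c x v ⊗ₜ[K] (y ^ v) := twistElt_eq_right c x y
    rw [hr, map_sum, map_sum, ← sum_idem hc hp x]
    refine Finset.sum_congr rfl fun v _ => ?_
    simp [gy.counit_eq_one]

end Algebra

/-- The twist `J = (1/p) ∑_{u,v} ζ^{-uv} τ^u ⊗ σ^v` of the group algebra `K G`. -/
noncomputable def groupTwist {K : Type*} [Field K] {p q : ℕ} [NeZero p] (r : (ZMod q)ˣ)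
    (hr : orderOf r = p) {ζ : K} (hζ : IsPrimitiveRoot ζ p) :
    HopfTwist K (MonoidAlgebra K (G r hr)) :=
  twist hζ (NeZero.ne p)
    (x := MonoidAlgebra.of K (G r hr) (τ r hr)) (y := MonoidAlgebra.of K (G r hr) (σ r hr))
    (by rw [← map_pow, τ_pow, map_one]) (by rw [← map_pow, σ_pow, map_one])
    ((commute_σ_τ r hr).symm.map (MonoidAlgebra.of K (G r hr)))
    (MonoidAlgebra.isGroupLikeElem_of (τ r hr)) (MonoidAlgebra.isGroupLikeElem_of (σ r hr))

/-- The Hopf algebra `B_{p,q}(ζ) = (K G)_J` over `K`. -/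
abbrev B {K : Type*} [Field K] {p q : ℕ} [NeZero p] (r : (ZMod q)ˣ)
    (hr : orderOf r = p) {ζ : K} (hζ : IsPrimitiveRoot ζ p) : Type _ :=
  (groupTwist r hr hζ).Twisted

lemma isPrimitiveRoot_gen {p : ℕ} {ζ : ℂ} (hζ : IsPrimitiveRoot ζ p) :
    IsPrimitiveRoot (IntermediateField.AdjoinSimple.gen ℚ ζ) p :=
  IsPrimitiveRoot.of_map_of_injective (f := algebraMap ℚ⟮ζ⟯ ℂ) (by simpa using hζ)
    (algebraMap ℚ⟮ζ⟯ ℂ).injective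

end GalindoNatale

section HopfOrder

open Coalgebra HopfAlgebra

/-- An order over `R` of a finite-dimensional `K`-vector space `V`, where `R ⊆ K`: a finitely
generated projective `R`-submodule `X` of `V` such that the natural map `K ⊗_R X → V` is an
isomorphism. -/
structure IsModuleOrder (R K : Type*) {V : Type*} [CommRing R] [Field K] [Algebra R K]
    [FaithfulSMul R K] [AddCommGroup V] [Module R V] [Module K V] [IsScalarTower R K V]
    (X : Submodule R V) : Prop where
  finite : Module.Finite R X
  projective : Module.Projective R X
  bijective : Function.Bijective (X.subtype.liftBaseChange K)

/-- A Hopf order over `R` of a Hopf algebra `H` over `K`, where `R ⊆ K`: an order `X` of `H` with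
`1 ∈ X`, `X X ⊆ X`, `Δ(X) ⊆ X ⊗_R X` (viewed inside `H ⊗_K H` as the `R`-span of the `x ⊗ y`
with `x, y ∈ X`), `ε(X) ⊆ R` and `S(X) ⊆ X`. -/
structure IsHopfOrder (R K : Type*) {H : Type*} [CommRing R] [Field K] [Algebra R K]
    [FaithfulSMul R K] [Ring H] [HopfAlgebra K H] [Module R H] [IsScalarTower R K H]
    (X : Submodule R H) : Prop extends IsModuleOrder R K X where
  one_mem : (1 : H) ∈ X
  mul_mem : ∀ x ∈ X, ∀ y ∈ X, x * y ∈ X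
  comul_mem : ∀ x ∈ X, comul (R := K) x ∈
    Submodule.span R {z : H ⊗[K] H | ∃ x ∈ X, ∃ y ∈ X, z = x ⊗ₜ[K] y}
  counit_mem : ∀ x ∈ X, counit (R := K) x ∈ (algebraMap R K).range
  antipode_mem : ∀ x ∈ X, antipode K x ∈ X

end HopfOrder

/-!
Semisimplicity is Maschke's theorem, as the twisted Hopf algebra is the group algebra as an algebra.

A Hopf order generates, over the ring of all algebraic integers, an integral form of the complex
Hopf algebra (`IsHopfOrder.exists_isIntegralForm`). Its elements are integral, so the characters of
modules take integral values on it. Since a finitely generated projective module has a finite dual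
basis, the same argument for the dual Hopf algebra shows that the characters of comodules belong to
it (`IsIntegralForm.sum_diag_mem`). It is also stable under `y ↦ (χ ⊗ id)(Δ y)` for every character
`χ` of a module.

Let `f_n` and `e_n` be the idempotents on which `τ` and `σ` act by `ζ^n`. In the twist, the
elements `σ^s a^i σ^{-s} f_{t-s}` are the matrix coefficients of a `p`-dimensional comodule, and so
are the elements `τ^t b^j τ^{-t} e_{s-t}` (`comul_aCoeff`, `comul_bCoeff`). The product `z` of the
characters of these two comodules lies in the integral form. Let `ψ` be a nontrivial character of
`ℤ_q`, let `η_i = ∑_s ψ (r^s i)` be its Gauss periods, and let `χ` be the character of the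
representation of `G = G₁ × G₂` of dimension `p^2` obtained by inducing `ψ` on both factors. It
vanishes on an element of `G` unless both `σ` and `τ` are absent from it, so it takes the value
`η_i η_j / p^2` on every product of a coefficient of the first comodule and one of the second.
Therefore `(χ ⊗ id)(Δ z) = (η_i η_j / p^2) A B`, where `A` and `B` are the sums of the conjugates of
`a^i` and of `b^j`. This element acts on the same representation as the scalar `(η_i η_j / p)^2`, so
`η_i η_j / p` is an algebraic integer for all `i` and `j`. The Gauss periods of the cosets of `⟨r⟩`
add up to `-1` (`sum_period_out`); summing `η_i η_j / p` over all pairs of cosets shows that `1 / p`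
is an algebraic integer, which is absurd.
-/

/-! ### Integral forms of Hopf algebras -/

section IntegralForm

open Coalgebra

/-- An integral form of a bialgebra `H` over `F`: a subalgebra `Y` over the ring of all algebraic
integers of `F` which is stable under the comultiplication, on which the counit takes algebraic
integers as values, and which has a finite dual basis, that is, elements `x k ∈ Y` and functionals
`f k` integral on `Y` with `h = ∑ k, f k h • x k` for all `h : H`. -/
structure IsIntegralForm {F H : Type*} [Field F] [Ring H] [Bialgebra F H]
    (Y : Subalgebra (integralClosure ℤ F) H) : Prop where
  comul_mem : ∀ y ∈ Y, comul (R := F) y ∈ Submodule.span (integralClosure ℤ F)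
    {z : H ⊗[F] H | ∃ x ∈ Y, ∃ y ∈ Y, z = x ⊗ₜ[F] y}
  counit_mem : ∀ y ∈ Y, IsIntegral ℤ (counit (R := F) y)
  exists_dualBasis : ∃ (n : ℕ) (x : Fin n → H) (f : Fin n → H →ₗ[F] F), (∀ k, x k ∈ Y) ∧
    (∀ k, ∀ y ∈ Y, IsIntegral ℤ (f k y)) ∧ ∀ h, ∑ k, f k h • x k = h

/-- The algebraic integers of a field `F` as a submodule of `F`. -/
def integralSubmodule (F : Type*) [Field F] : Submodule (integralClosure ℤ F) F where
  carrier := {c | IsIntegral ℤ c}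
  zero_mem' := isIntegral_zero
  add_mem' := IsIntegral.add
  smul_mem' c _ hx := c.2.mul hx

/-- The trace of an integral matrix is the sum of its eigenvalues, which are integral. -/
lemma Matrix.isIntegral_trace_of_isIntegral {F n : Type*} [Field F] [IsAlgClosed F] [Fintype n]
    [DecidableEq n] {M : Matrix n n F} (hM : IsIntegral (integralClosure ℤ F) M) :
    IsIntegral ℤ M.trace := by
  obtain ⟨f, hf, hfM⟩ := hM
  rw [Matrix.trace_eq_sum_roots_charpoly]
  refine multiset_sum_mem (S := integralClosure ℤ F) _ fun μ hμ => ?_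
  have hμ' : μ ∈ spectrum F M :=
    Matrix.mem_spectrum_iff_isRoot_charpoly.mpr (Polynomial.isRoot_of_mem_roots hμ)
  have hMf : Polynomial.aeval M (f.map (algebraMap (integralClosure ℤ F) F)) = 0 := by
    rw [Polynomial.aeval_map_algebraMap]
    exact hfM
  have h0 := spectrum.subset_polynomial_aeval M (f.map (algebraMap (integralClosure ℤ F) F))
    ⟨μ, hμ', rfl⟩
  rw [hMf] at h0
  have : Nontrivial (Matrix n n F) := by
    by_contra hn
    rw [not_nontrivial_iff_subsingleton] at hn
    simp [spectrum.of_subsingleton] at hμ'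
  rw [spectrum.zero_eq, Set.mem_singleton_iff] at h0
  beta_reduce at h0
  rw [Polynomial.eval_map] at h0
  exact isIntegral_trans μ ⟨f, hf, h0⟩

namespace IsIntegralForm

variable {F H : Type*} [Field F] [Ring H] [Bialgebra F H]
  {Y : Subalgebra (integralClosure ℤ F) H}

lemma fg (hY : IsIntegralForm Y) : (Subalgebra.toSubmodule Y).FG := by
  obtain ⟨n, x, f, hx, hf, hxf⟩ := hY.exists_dualBasis
  rw [Submodule.fg_iff_exists_fin_generating_family]
  refine ⟨n, x, le_antisymm (Submodule.span_le.mpr ?_) fun y hy => ?_⟩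
  · rintro _ ⟨k, rfl⟩
    exact hx k
  · rw [← hxf y]
    exact Submodule.sum_mem _ fun k _ => Submodule.smul_mem _
      (⟨f k y, hf k y hy⟩ : integralClosure ℤ F) (Submodule.subset_span ⟨k, rfl⟩)

lemma isIntegral (hY : IsIntegralForm Y) {y : H} (hy : y ∈ Y) :
    IsIntegral (integralClosure ℤ F) y :=
  IsIntegral.of_mem_of_fg Y hY.fg y hy

lemma isIntegral_trace [IsAlgClosed F] {n : Type*} [Fintype n] [DecidableEq n]
    (hY : IsIntegralForm Y) (ρ : H →ₐ[F] Matrix n n F) {y : H} (hy : y ∈ Y) :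
    IsIntegral ℤ (ρ y).trace :=
  Matrix.isIntegral_trace_of_isIntegral ((hY.isIntegral hy).map ρ)

lemma isIntegral_of_map_eq_algebraMap {A : Type*} [Ring A] [Algebra F A] [Nontrivial A]
    (hY : IsIntegralForm Y) (ρ : H →ₐ[F] A) {y : H} (hy : y ∈ Y) {c : F}
    (hc : ρ y = algebraMap F A c) : IsIntegral ℤ c := by
  have h := (hY.isIntegral hy).map ρ
  rw [hc, isIntegral_algebraMap_iff (algebraMap F A).injective] at h
  exact isIntegral_trans c h

lemma lift_comul_mem (hY : IsIntegralForm Y) {M : Type*} [AddCommGroup M] [Module F M]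
    (N : Submodule (integralClosure ℤ F) M) (φ : H ⊗[F] H →ₗ[F] M)
    (hφ : ∀ x ∈ Y, ∀ y ∈ Y, φ (x ⊗ₜ y) ∈ N) {y : H} (hy : y ∈ Y) :
    φ (comul y) ∈ N := by
  have h : Submodule.span (integralClosure ℤ F)
      {z : H ⊗[F] H | ∃ x ∈ Y, ∃ y ∈ Y, z = x ⊗ₜ[F] y} ≤
      N.comap (φ.restrictScalars (integralClosure ℤ F)) := by
    rw [Submodule.span_le]
    rintro _ ⟨x, hx, y, hy, rfl⟩
    exact hφ x hx y hy
  exact h (hY.comul_mem y hy)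

/-- An integral form is stable under the contraction of one tensor factor of the comultiplication
with a functional which takes integral values on it. -/
lemma contract_comul_mem (hY : IsIntegralForm Y) {χ : H →ₗ[F] F}
    (hχ : ∀ y ∈ Y, IsIntegral ℤ (χ y)) {y : H} (hy : y ∈ Y) :
    TensorProduct.lid F H (χ.rTensor H (comul y)) ∈ Y := by
  refine hY.lift_comul_mem (Subalgebra.toSubmodule Y)
    ((TensorProduct.lid F H).toLinearMap ∘ₗ χ.rTensor H) (fun x hx y hy => ?_) hy
  simp only [LinearMap.comp_apply, LinearMap.rTensor_tmul, LinearEquiv.coe_coe,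
    TensorProduct.lid_tmul]
  exact (Subalgebra.toSubmodule Y).smul_mem (⟨χ x, hχ x hx⟩ : integralClosure ℤ F) hy

/-- An integral form contains the character `∑ i, C i i` of every finite-dimensional comodule,
given here by its matrix `C` of coefficients. This is the dual of the fact that the characters of
modules are integral on it: a functional `f` which is integral on the form acts on the comodule by
the matrix `f (C i j)`, and these matrices form an algebra finite over the algebraic integers, so
that the trace of each of them is integral. -/
lemma sum_diag_mem [IsAlgClosed F] {n : Type*} [Fintype n] [DecidableEq n]
    (hY : IsIntegralForm Y) (C : n → n → H)
    (hC : ∀ i j, comul (R := F) (C i j) = ∑ k, C i k ⊗ₜ C k j)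
    (hε : ∀ i j, counit (R := F) (C i j) = if i = j then 1 else 0) :
    ∑ i, C i i ∈ Y := by
  -- the action of functionals on the comodule, multiplicative for the convolution product
  let π : (H →ₗ[F] F) →ₗ[F] Matrix n n F :=
    { toFun f := Matrix.of fun i j => f (C i j)
      map_add' _ _ := rfl
      map_smul' _ _ := rfl }
  let conv (f g : H →ₗ[F] F) : H →ₗ[F] F :=
    LinearMap.mul' F F ∘ₗ TensorProduct.map f g ∘ₗ comul
  have hπ_apply f i j : π f i j = f (C i j) := rfl
  have hπ f g : π (conv f g) = π f * π g := by
    ext i j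
    simp [hπ_apply, conv, hC, Matrix.mul_apply]
  -- the order of all matrices by which functionals integral on the form act
  let P : Subalgebra (integralClosure ℤ F) (Matrix n n F) :=
    { carrier := {M | ∃ f, (∀ y ∈ Y, IsIntegral ℤ (f y)) ∧ π f = M}
      mul_mem' := by
        rintro _ _ ⟨f, hf, rfl⟩ ⟨g, hg, rfl⟩
        refine ⟨conv f g, fun y hy => ?_, hπ f g⟩
        exact hY.lift_comul_mem (integralSubmodule F)
          (LinearMap.mul' F F ∘ₗ TensorProduct.map f g)
          (fun x hx y hy => (hf x hx).mul (hg y hy)) hy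
      add_mem' := by
        rintro _ _ ⟨f, hf, rfl⟩ ⟨g, hg, rfl⟩
        exact ⟨f + g, fun y hy => (hf y hy).add (hg y hy), map_add π f g⟩
      algebraMap_mem' c := by
        refine ⟨(c : F) • counit, fun y hy => c.2.mul (hY.counit_mem y hy), ?_⟩
        ext i j
        rw [hπ_apply, LinearMap.smul_apply, hε, Matrix.algebraMap_matrix_apply]
        split_ifs
        · exact mul_one _
        · exact mul_zero _ }
  obtain ⟨m, x, f, hx, hf, hxf⟩ := hY.exists_dualBasis
  have hPfg : (Subalgebra.toSubmodule P).FG := by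
    rw [Submodule.fg_iff_exists_fin_generating_family]
    refine ⟨m, fun k => π (f k), le_antisymm (Submodule.span_le.mpr ?_) ?_⟩
    · rintro _ ⟨k, rfl⟩
      exact ⟨f k, hf k, rfl⟩
    · rintro _ ⟨g, hg, rfl⟩
      have hgf : g = ∑ k, g (x k) • f k := by
        ext h
        conv_lhs => rw [← hxf h]
        simp [mul_comm]
      rw [hgf, map_sum]
      exact Submodule.sum_mem _ fun k _ => map_smul π (g (x k)) (f k) ▸
        Submodule.smul_mem _ (⟨g (x k), hg _ (hx k)⟩ : integralClosure ℤ F)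
          (Submodule.subset_span ⟨k, rfl⟩)
  rw [← hxf (∑ i, C i i)]
  refine Subalgebra.sum_mem _ fun k _ => ?_
  have hk : IsIntegral ℤ (f k (∑ i, C i i)) := by
    have h := Matrix.isIntegral_trace_of_isIntegral
      (IsIntegral.of_mem_of_fg P hPfg (π (f k)) ⟨f k, hf k, rfl⟩)
    rw [map_sum]
    exact h
  exact (Subalgebra.toSubmodule Y).smul_mem (⟨_, hk⟩ : integralClosure ℤ F) (hx k)

end IsIntegralForm

/-- The algebraic integers span an integral form on a Hopf order over a ring of algebraic
integers. -/
lemma IsHopfOrder.exists_isIntegralForm {R F H : Type*} [CommRing R] [Field F] [Algebra R F]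
    [FaithfulSMul R F] [Ring H] [HopfAlgebra F H] [Module R H] [IsScalarTower R F H]
    [Algebra.IsIntegral ℤ R] {X : Submodule R H} (hX : IsHopfOrder R F X) :
    ∃ Y : Subalgebra (integralClosure ℤ F) H, IsIntegralForm Y := by
  have hR (c : R) : IsIntegral ℤ (algebraMap R F c) :=
    (Algebra.IsIntegral.isIntegral (R := ℤ) c).algebraMap
  have hmul : ∀ x ∈ Submodule.span (integralClosure ℤ F) (X : Set H),
      ∀ y ∈ Submodule.span (integralClosure ℤ F) (X : Set H),
      x * y ∈ Submodule.span (integralClosure ℤ F) (X : Set H) := by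
    intro x hx y hy
    induction hx using Submodule.span_induction with
    | zero => simp
    | add a b _ _ ha hb => simpa [add_mul] using add_mem ha hb
    | smul c a _ ha => simpa using Submodule.smul_mem _ c ha
    | mem x hx =>
      induction hy using Submodule.span_induction with
      | zero => simp
      | add a b _ _ ha hb => simpa [mul_add] using add_mem ha hb
      | smul c a _ ha => simpa using Submodule.smul_mem _ c ha
      | mem y hy => exact Submodule.subset_span (hX.mul_mem x hx y hy)
  let Y : Subalgebra (integralClosure ℤ F) H :=
    (Submodule.span (integralClosure ℤ F) (X : Set H)).toSubalgebra
      (Submodule.subset_span hX.one_mem) (fun x y hx hy => hmul x hx y hy)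
  have hXY {x : H} (hx : x ∈ X) : x ∈ Y := Submodule.subset_span hx
  have hind (N : Submodule (integralClosure ℤ F) F) (f : H →ₗ[F] F)
      (hf : ∀ x ∈ X, f x ∈ N) (y : H) (hy : y ∈ Y) : f y ∈ N := by
    have h : Submodule.span (integralClosure ℤ F) (X : Set H) ≤
        N.comap (f.restrictScalars (integralClosure ℤ F)) := Submodule.span_le.mpr hf
    exact h hy
  refine ⟨Y, fun y hy => ?_, ?_, ?_⟩
  · have h : Submodule.span (integralClosure ℤ F) (X : Set H) ≤
        (Submodule.span (integralClosure ℤ F)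
          {z : H ⊗[F] H | ∃ x ∈ Y, ∃ y ∈ Y, z = x ⊗ₜ[F] y}).comap
          ((comul (R := F) (A := H)).restrictScalars (integralClosure ℤ F)) := by
      refine Submodule.span_le.mpr fun x hx => ?_
      have hx' := hX.comul_mem x hx
      refine Submodule.span_induction (p := fun z _ => z ∈ Submodule.span (integralClosure ℤ F)
          {z : H ⊗[F] H | ∃ x ∈ Y, ∃ y ∈ Y, z = x ⊗ₜ[F] y}) ?_ (zero_mem _)
        (fun _ _ _ _ ha hb => add_mem ha hb) (fun c a _ ha => ?_) hx'
      · rintro _ ⟨x, hx, y, hy, rfl⟩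
        exact Submodule.subset_span ⟨x, hXY hx, y, hXY hy, rfl⟩
      · rw [← algebraMap_smul F c a]
        exact Submodule.smul_mem _ (⟨_, hR c⟩ : integralClosure ℤ F) ha
    exact h hy
  · refine hind (integralSubmodule F) counit ?_
    intro x hx
    obtain ⟨c, hc⟩ := hX.counit_mem x hx
    exact hc ▸ hR c
  · have := hX.finite
    have := hX.projective
    obtain ⟨n, f, g, -, -, hfg⟩ := Module.Finite.exists_comp_eq_id_of_projective R X
    let e := LinearEquiv.ofBijective _ hX.bijective
    -- the coordinate functionals of the projective module `X`, extended linearly to `H`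
    let φ (k : Fin n) : H →ₗ[F] F :=
      (Algebra.linearMap R F ∘ₗ LinearMap.proj k ∘ₗ g).liftBaseChange F ∘ₗ e.symm.toLinearMap
    have hφ (k : Fin n) (x : X) : φ k x = algebraMap R F (g x k) := by
      have he : e.symm (x : H) = 1 ⊗ₜ x := by
        rw [LinearEquiv.symm_apply_eq]
        simp [e]
      simp [φ, he]
    refine ⟨n, fun k => f (Pi.single k 1), φ, fun k => hXY (f (Pi.single k 1)).2, fun k =>
      hind (integralSubmodule F) (φ k) ?_, fun h => ?_⟩
    · intro x hx
      exact hφ k ⟨x, hx⟩ ▸ hR _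
    · obtain ⟨t, rfl⟩ := e.surjective h
      induction t with
      | zero => simp
      | add a b ha hb => simp only [map_add, add_smul, Finset.sum_add_distrib, ha, hb]
      | tmul c x =>
        have hx : e (c ⊗ₜ x) = c • (x : H) := by simp [e]
        rw [hx]
        simp only [map_smul, smul_eq_mul, mul_smul, ← Finset.smul_sum, hφ, algebraMap_smul]
        congr 1
        have h1 := congr(($hfg x : H))
        rw [LinearMap.comp_apply, pi_eq_sum_univ' (g x), map_sum] at h1
        simpa using h1

end IntegralForm

/-! ### Matrix coefficients in the twisted coalgebra -/

namespace GalindoNatale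

open Coalgebra Bialgebra HopfAlgebra

lemma sum_range_eq_sum_zmod {p : ℕ} [NeZero p] {M : Type*} [AddCommMonoid M] (F : ℕ → M) :
    ∑ u ∈ Finset.range p, F u = ∑ u : ZMod p, F u.val := by
  refine (Finset.sum_nbij' (fun u : ZMod p => u.val) (fun u : ℕ => (u : ZMod p))
    ?_ ?_ ?_ ?_ ?_).symm
  · intro u _
    simpa using u.val_lt
  · simp
  · simp
  · intro u hu
    exact ZMod.val_cast_of_lt (Finset.mem_range.mp hu)
  · simp

lemma pow_val_add {p : ℕ} [NeZero p] {M : Type*} [Monoid M] {c : M} (hc : c ^ p = 1)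
    (m n : ZMod p) : c ^ (m + n).val = c ^ m.val * c ^ n.val := by
  rw [ZMod.val_add, ← pow_eq_pow_mod _ hc, pow_add]

section Idem

variable {K A : Type*} [Field K] [Ring A] [Algebra K A] {p : ℕ} [NeZero p] {c : K}

lemma idem_val (x : A) (n : ZMod p) :
    idem p c x n.val = (p : K)⁻¹ • ∑ u : ZMod p, c⁻¹ ^ (u.val * n.val) • x ^ u.val := by
  rw [idem, sum_range_eq_sum_zmod]

lemma sum_idem_zmod (hc : IsPrimitiveRoot c p) (x : A) :
    ∑ n : ZMod p, idem p c x n.val = 1 := by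
  rw [← sum_range_eq_sum_zmod fun n => idem p c x n, sum_idem hc (NeZero.ne p)]

lemma idem_mul_idem (hc : IsPrimitiveRoot c p) {x : A} (hx : x ^ p = 1) (m n : ZMod p) :
    idem p c x m.val * idem p c x n.val = if m = n then idem p c x n.val else 0 := by
  have hp : (p : K) ≠ 0 := (hc.neZero').out
  have hc0 : c ≠ 0 := hc.ne_zero (NeZero.ne p)
  have h0 : ∑ u : ZMod p, c⁻¹ ^ (u.val * m.val) * c ^ (u.val * n.val) =
      if m = n then (p : K) else 0 := by
    have h1 : ∀ u : ZMod p, c⁻¹ ^ (u.val * m.val) * c ^ (u.val * n.val) =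
        AddChar.zmodChar p hc.pow_eq_one (u * (n - m)) := by
      intro u
      rw [mul_sub, AddChar.map_sub_eq_div, ← ZMod.natCast_zmod_val u, ← ZMod.natCast_zmod_val n,
        ← ZMod.natCast_zmod_val m, ← Nat.cast_mul, ← Nat.cast_mul, AddChar.zmodChar_apply',
        AddChar.zmodChar_apply']
      simp [div_eq_inv_mul]
    simp_rw [h1]
    rw [AddChar.sum_mulShift _ (AddChar.zmodChar_primitive_of_primitive_root p hc)]
    simp [sub_eq_zero, eq_comm]
  rw [idem_val x m, smul_mul_assoc, Finset.sum_mul]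
  simp_rw [smul_mul_assoc, pow_mul_idem hc.pow_eq_one (NeZero.ne p) hx, smul_smul]
  rw [← Finset.sum_smul, h0, smul_smul]
  split_ifs
  · rw [inv_mul_cancel₀ hp, one_smul]
  · simp

lemma commute_idem {p : ℕ} {g x : A} (h : Commute g x) (n : ℕ) : Commute g (idem p c x n) :=
  (Commute.sum_right _ _ _ fun u _ => (h.pow_right u).smul_right _).smul_right _

end Idem

section Twist

variable {K A : Type*} [Field K] [Ring A] [HopfAlgebra K A] {p : ℕ} [NeZero p] {c : K}

lemma counit_idem (hc : IsPrimitiveRoot c p) {x : A} (gx : IsGroupLikeElem K x) (n : ZMod p) :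
    counit (R := K) (idem p c x n.val) = if n = 0 then 1 else 0 := by
  have h := idem_mul_idem (A := K) hc (one_pow p) n 0
  have h1 (n : ℕ) : counit (R := K) (idem p c x n) = idem p c (1 : K) n := by
    simp [idem, gx.counit_eq_one]
  have h0 : idem p c (1 : K) (0 : ZMod p).val = 1 := by
    have hp : (p : K) ≠ 0 := (hc.neZero').out
    simp [idem, hp]
  rw [h0, mul_one] at h
  rw [h1, h]

lemma comul_idem (hc : IsPrimitiveRoot c p) {x : A} (hx : x ^ p = 1) (gx : IsGroupLikeElem K x)
    (n : ZMod p) : comul (R := K) (idem p c x n.val) =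
      ∑ i : ZMod p, idem p c x i.val ⊗ₜ idem p c x (n - i).val := by
  have hpow (u : ℕ) : x ^ u = ∑ i : ZMod p, c ^ (u * i.val) • idem p c x i.val := by
    conv_lhs => rw [← mul_one (x ^ u), ← sum_idem_zmod hc x, Finset.mul_sum]
    simp_rw [pow_mul_idem hc.pow_eq_one (NeZero.ne p) hx]
  have hcomul (u : ℕ) : comul (R := K) (x ^ u) = (x ^ u) ⊗ₜ (x ^ u) := by
    rw [Bialgebra.comul_pow, gx.comul_eq_tmul_self, Algebra.TensorProduct.tmul_pow]
  have hcoef (u i : ZMod p) : c⁻¹ ^ (u.val * n.val) * c ^ (u.val * i.val) =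
      c⁻¹ ^ (u.val * (n - i).val) := by
    have h := pow_val_add hc.pow_eq_one (n - i) i
    rw [sub_add_cancel] at h
    have hc0 : c ^ i.val ≠ 0 := pow_ne_zero _ (hc.ne_zero (NeZero.ne p))
    rw [mul_comm u.val, mul_comm u.val, mul_comm u.val, pow_mul, pow_mul, pow_mul, inv_pow, h,
      ← mul_pow, mul_inv, mul_assoc, inv_mul_cancel₀ hc0, mul_one]
    simp only [inv_pow]
  rw [idem_val]
  simp_rw [map_smul, map_sum, map_smul, hcomul]
  have h1 (u : ZMod p) : c⁻¹ ^ (u.val * n.val) • ((x ^ u.val) ⊗ₜ[K] (x ^ u.val)) =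
      ∑ i : ZMod p, idem p c x i.val ⊗ₜ (c⁻¹ ^ (u.val * (n - i).val) • x ^ u.val) := by
    conv_lhs => rw [hpow u.val, TensorProduct.sum_tmul, Finset.smul_sum]
    refine Finset.sum_congr rfl fun i _ => ?_
    rw [← TensorProduct.smul_tmul', smul_smul, hcoef, ← TensorProduct.tmul_smul, ← hpow]
  simp_rw [h1, idem_val x (n - _), TensorProduct.tmul_smul, TensorProduct.tmul_sum,
    ← Finset.smul_sum]
  rw [Finset.sum_comm]
  simp_rw [TensorProduct.tmul_smul]

variable (hc : IsPrimitiveRoot c p) {x y : A} (hx : x ^ p = 1) (hy : y ^ p = 1)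
  (hxy : Commute x y) (gx : IsGroupLikeElem K x) (gy : IsGroupLikeElem K y)

/-- The comultiplication of a twist is characterised by `Δ_J(h) J = J Δ(h)`. -/
lemma _root_.HopfTwist.comulTwist_eq_iff (T : HopfTwist K A) (h : A) (z : A ⊗[K] A) :
    T.comulTwist h = z ↔ z * (T.J : A ⊗[K] A) = (T.J : A ⊗[K] A) * comul h := by
  rw [T.comulTwist_apply, Units.mul_inv_eq_iff_eq_mul, eq_comm]

/-- Group-like elements `g s = y^s g y^{-s}` commuting with `x` give, with the idempotents `f_n` of
`x`, matrix coefficients `g s * f_(t - s)` of a comodule over the twist. -/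
lemma comulTwist_mul_idem_left {g : ZMod p → A} (hg : ∀ s, Commute (g s) x)
    (gg : ∀ s, IsGroupLikeElem K (g s)) (hgy : ∀ s v, y ^ v.val * g s = g (s + v) * y ^ v.val)
    (s n : ZMod p) :
    (twist hc (NeZero.ne p) hx hy hxy gx gy).comulTwist (g s * idem p c x n.val) =
      ∑ v : ZMod p, (g s * idem p c x v.val) ⊗ₜ (g (s + v) * idem p c x (n - v).val) := by
  have hJ : ((twist hc (NeZero.ne p) hx hy hxy gx gy).J : A ⊗[K] A) =
      ∑ v : ZMod p, idem p c x v.val ⊗ₜ[K] (y ^ v.val) :=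
    (twistElt_eq_right c x y).trans (sum_range_eq_sum_zmod _)
  have hJ_mul (i : ZMod p) (b : A) : ((g s * idem p c x i.val) ⊗ₜ[K] b) *
      ∑ v : ZMod p, idem p c x v.val ⊗ₜ[K] (y ^ v.val) =
        (g s * idem p c x i.val) ⊗ₜ[K] (b * y ^ i.val) := by
    simp_rw [Finset.mul_sum, Algebra.TensorProduct.tmul_mul_tmul, mul_assoc, idem_mul_idem hc hx]
    rw [Finset.sum_eq_single i (fun v _ hv => by simp [hv.symm]) (by simp), if_pos rfl]
  have hJ_comul (i v : ZMod p) : (idem p c x v.val ⊗ₜ[K] (y ^ v.val)) *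
      ((g s ⊗ₜ g s) * (idem p c x i.val ⊗ₜ idem p c x (n - i).val)) =
        if v = i then (g s * idem p c x i.val) ⊗ₜ[K]
          (g (s + i) * idem p c x (n - i).val * y ^ i.val) else 0 := by
    rw [Algebra.TensorProduct.tmul_mul_tmul, Algebra.TensorProduct.tmul_mul_tmul, ← mul_assoc,
      ← (commute_idem (hg s) v.val).eq, mul_assoc, idem_mul_idem hc hx, ← mul_assoc, hgy]
    split_ifs with h
    · subst h
      rw [mul_assoc, ((commute_idem hxy.symm _).pow_left _).eq, ← mul_assoc]
    · simp
  rw [HopfTwist.comulTwist_eq_iff, hJ, Bialgebra.comul_mul, (gg s).comul_eq_tmul_self,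
    comul_idem hc hx gx, Finset.sum_mul]
  simp_rw [hJ_mul, Finset.mul_sum, Finset.sum_mul, hJ_comul]
  simp

/-- The mirror image of `comulTwist_mul_idem_left`, for group-like elements commuting with `y`. -/
lemma comulTwist_mul_idem_right {g : ZMod p → A} (hg : ∀ s, Commute (g s) y)
    (gg : ∀ s, IsGroupLikeElem K (g s)) (hgx : ∀ s v, x ^ v.val * g s = g (s + v) * x ^ v.val)
    (s n : ZMod p) :
    (twist hc (NeZero.ne p) hx hy hxy gx gy).comulTwist (g s * idem p c y n.val) =
      ∑ v : ZMod p, (g (s + v) * idem p c y (n - v).val) ⊗ₜ (g s * idem p c y v.val) := by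
  have hJ : ((twist hc (NeZero.ne p) hx hy hxy gx gy).J : A ⊗[K] A) =
      ∑ v : ZMod p, (x ^ v.val) ⊗ₜ[K] idem p c y v.val :=
    (twistElt_eq_left c x y).trans (sum_range_eq_sum_zmod _)
  have hJ_mul (i : ZMod p) (b : A) : (b ⊗ₜ[K] (g s * idem p c y i.val)) *
      ∑ v : ZMod p, (x ^ v.val) ⊗ₜ[K] idem p c y v.val =
        (b * x ^ i.val) ⊗ₜ[K] (g s * idem p c y i.val) := by
    simp_rw [Finset.mul_sum, Algebra.TensorProduct.tmul_mul_tmul, mul_assoc, idem_mul_idem hc hy]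
    rw [Finset.sum_eq_single i (fun v _ hv => by simp [hv.symm]) (by simp), if_pos rfl]
  have hJ_comul (i v : ZMod p) : ((x ^ v.val) ⊗ₜ[K] idem p c y v.val) *
      ((g s ⊗ₜ g s) * (idem p c y (n - i).val ⊗ₜ idem p c y i.val)) =
        if v = i then (g (s + i) * idem p c y (n - i).val * x ^ i.val) ⊗ₜ[K]
          (g s * idem p c y i.val) else 0 := by
    rw [Algebra.TensorProduct.tmul_mul_tmul, Algebra.TensorProduct.tmul_mul_tmul,
      ← mul_assoc (idem p c y v.val), ← (commute_idem (hg s) v.val).eq, mul_assoc (g s),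
      idem_mul_idem hc hy, ← mul_assoc, hgx]
    split_ifs with h
    · subst h
      rw [mul_assoc, ((commute_idem hxy _).pow_left _).eq, ← mul_assoc]
    · simp
  have hcomul : comul (R := K) (idem p c y n.val) =
      ∑ i : ZMod p, idem p c y (n - i).val ⊗ₜ idem p c y i.val := by
    rw [comul_idem hc hy gy, ← Equiv.sum_comp (Equiv.subLeft n)]
    simp
  rw [HopfTwist.comulTwist_eq_iff, hJ, Bialgebra.comul_mul, (gg s).comul_eq_tmul_self,
    hcomul, Finset.sum_mul]
  simp_rw [hJ_mul, Finset.mul_sum, Finset.sum_mul, hJ_comul]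
  simp

end Twist

end GalindoNatale

/-! ### Semisimplicity -/

/-- The base change of a group algebra of a finite group to a field of characteristic zero is a
quotient of a group algebra, hence semisimple by Maschke's theorem. -/
lemma MonoidAlgebra.isSemisimpleRing_baseChange (K F G : Type*) [Field K] [Field F] [CharZero F]
    [Algebra K F] [Group G] [Finite G] : IsSemisimpleRing (F ⊗[K] MonoidAlgebra K G) := by
  have : NeZero (Nat.card G : F) := ⟨by exact_mod_cast Nat.card_pos.ne'⟩
  let f : MonoidAlgebra F G →ₐ[F] F ⊗[K] MonoidAlgebra K G :=
    MonoidAlgebra.lift F _ G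
      ((Algebra.TensorProduct.includeRight : MonoidAlgebra K G →ₐ[K] F ⊗[K] MonoidAlgebra K G)
        |>.toMonoidHom.comp (MonoidAlgebra.of K G))
  have hf : Function.Surjective f := by
    intro z
    induction z with
    | zero => exact ⟨0, map_zero f⟩
    | add a b ha hb =>
      obtain ⟨a, rfl⟩ := ha
      obtain ⟨b, rfl⟩ := hb
      exact ⟨a + b, map_add f a b⟩
    | tmul c x =>
      induction x using MonoidAlgebra.induction_linear with
      | zero => exact ⟨0, by simp⟩
      | add a b ha hb =>
        obtain ⟨a', ha⟩ := ha
        obtain ⟨b', hb⟩ := hb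
        exact ⟨a' + b', by rw [map_add, ha, hb, TensorProduct.tmul_add]⟩
      | single g k =>
        refine ⟨MonoidAlgebra.single g (k • c), ?_⟩
        simp only [f, MonoidAlgebra.lift_single]
        simp [TensorProduct.smul_tmul', TensorProduct.smul_tmul]
  exact f.toRingHom.isSemisimpleRing_of_surjective hf

/-! ### Contracting the comultiplication of a product of characters -/

section

open Coalgebra

/-- If a functional `χ` that is integral on the form takes the constant value `γ` on the products
of the coefficients of two comodules, then contracting the comultiplication of the product of
their characters with `χ` multiplies the product of the sums of all coefficients by `γ`. -/
lemma IsIntegralForm.smul_sum_mul_sum_mem {F H ι κ : Type*} [Field F] [IsAlgClosed F] [Ring H]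
    [Bialgebra F H] [Fintype ι] [DecidableEq ι] [Fintype κ] [DecidableEq κ]
    {Y : Subalgebra (integralClosure ℤ F) H} (hY : IsIntegralForm Y)
    {C : ι → ι → H} (hC : ∀ i j, comul (R := F) (C i j) = ∑ k, C i k ⊗ₜ C k j)
    (hCε : ∀ i j, counit (R := F) (C i j) = if i = j then 1 else 0)
    {D : κ → κ → H} (hD : ∀ i j, comul (R := F) (D i j) = ∑ k, D i k ⊗ₜ D k j)
    (hDε : ∀ i j, counit (R := F) (D i j) = if i = j then 1 else 0)
    {χ : H →ₗ[F] F} (hχ : ∀ y ∈ Y, IsIntegral ℤ (χ y)) {γ : F}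
    (hγ : ∀ i j k l, χ (C i j * D k l) = γ) :
    γ • ((∑ i, ∑ j, C i j) * ∑ k, ∑ l, D k l) ∈ Y := by
  have h := hY.contract_comul_mem hχ (mul_mem (hY.sum_diag_mem C hC hCε) (hY.sum_diag_mem D hD hDε))
  convert h using 1
  rw [Bialgebra.comul_mul]
  simp_rw [map_sum, hC, hD, Finset.sum_mul, Finset.mul_sum, Finset.smul_sum, map_sum]
  simp only [Algebra.TensorProduct.tmul_mul_tmul, LinearMap.rTensor_tmul, TensorProduct.lid_tmul,
    hγ]
  rw [Finset.sum_comm]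
  refine Finset.sum_congr rfl fun i _ => Finset.sum_congr rfl fun j _ => ?_
  exact Finset.sum_comm

/-- A comodule over `H` given by a matrix of coefficients extends to the base change of `H`. -/
lemma comul_one_tmul_eq_sum {K F H ι : Type*} [Field K] [Field F] [Algebra K F] [Ring H]
    [Bialgebra K H] [Fintype ι] {h : H} {x y : ι → H}
    (hC : comul (R := K) h = ∑ k, x k ⊗ₜ y k) :
    comul (R := F) ((1 : F) ⊗ₜ[K] h) =
      ∑ k, ((1 : F) ⊗ₜ[K] x k) ⊗ₜ[F] ((1 : F) ⊗ₜ[K] y k) := by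
  rw [TensorProduct.comul_tmul, hC, TensorProduct.tmul_sum, map_sum]
  rfl

end

/-! ### Gauss periods and the induced representation -/

namespace GalindoNatale

open Multiplicative

variable {p q : ℕ} [NeZero p] (r : (ZMod q)ˣ) (hr : orderOf r = p) {F : Type*} [Field F]
  (ψ : AddChar (ZMod q) F)

/-- The Gauss period `∑_s ψ (r^s i)` of an additive character `ψ`. -/
noncomputable def period (i : ZMod q) : F :=
  ∑ s : ZMod p, ψ (action r hr (ofAdd s) (ofAdd i)).toAdd

lemma action_action (s t : ZMod p) (x : Multiplicative (ZMod q)) :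
    action r hr (ofAdd s) (action r hr (ofAdd t) x) = action r hr (ofAdd (s + t)) x := by
  rw [ofAdd_add, map_mul, MulAut.mul_apply]

lemma sum_action (s : ZMod p) (i : ZMod q) :
    ∑ t : ZMod p, ψ (action r hr (ofAdd s) (action r hr (ofAdd t) (ofAdd i))).toAdd =
      period r hr ψ i := by
  simp_rw [action_action]
  exact Equiv.sum_comp (Equiv.addLeft s)
    fun t : ZMod p => ψ (action r hr (ofAdd t) (ofAdd i)).toAdd

/-- The representation of `ℤ_q ⋊ ℤ_p` induced from the character `ψ` of `ℤ_q`. -/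
noncomputable def inducedRep : Factor r hr →* Matrix (ZMod p) (ZMod p) F where
  toFun g := Matrix.of fun s t =>
    if t = s + g.right.toAdd then ψ (action r hr (ofAdd s) g.left).toAdd else 0
  map_one' := by
    ext s t
    simp [Matrix.one_apply, eq_comm]
  map_mul' g h := by
    ext s t
    rw [Matrix.mul_apply, Finset.sum_eq_single (s + g.right.toAdd)
      (fun u _ hu => by simp [hu]) (by simp)]
    simp only [Matrix.of_apply, if_true, SemidirectProduct.mul_right,
      SemidirectProduct.mul_left, toAdd_mul, map_mul, AddChar.map_add_eq_mul, mul_ite, mul_zero,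
      add_assoc, ← action_action, ofAdd_toAdd]

lemma trace_inducedRep (g : Factor r hr) : (inducedRep r hr ψ g).trace =
    if g.right = 1 then period r hr ψ g.left.toAdd else 0 := by
  have h (s : ZMod p) : s = s + g.right.toAdd ↔ g.right = 1 := by
    rw [left_eq_add]
    rfl
  simp only [Matrix.trace, Matrix.diag_apply, inducedRep, MonoidHom.coe_mk, OneHom.coe_mk,
    Matrix.of_apply, h]
  split_ifs
  · rfl
  · simp

lemma period_action (s : ZMod p) (i : ZMod q) :
    period r hr ψ (action r hr (ofAdd s) (ofAdd i)).toAdd = period r hr ψ i := by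
  simp_rw [period, ofAdd_toAdd, action_action]
  exact Equiv.sum_comp (Equiv.addRight s)
    fun t : ZMod p => ψ (action r hr (ofAdd t) (ofAdd i)).toAdd

/-- The sum of the conjugates of `a^i` acts on the induced representation by a Gauss period. -/
lemma sum_inducedRep_inl (i : ZMod q) :
    ∑ s : ZMod p, inducedRep r hr ψ (SemidirectProduct.inl (action r hr (ofAdd s) (ofAdd i))) =
      period r hr ψ i • (1 : Matrix (ZMod p) (ZMod p) F) := by
  ext s t
  rw [Matrix.sum_apply, Matrix.smul_apply, Matrix.one_apply, smul_eq_mul]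
  simp only [inducedRep, MonoidHom.coe_mk, OneHom.coe_mk, Matrix.of_apply,
    SemidirectProduct.left_inl, SemidirectProduct.right_inl, toAdd_one, add_zero, eq_comm (a := t)]
  split_ifs
  · rw [sum_action, mul_one]
  · simp

/-- The Gauss periods belonging to the cosets of `⟨r⟩` in `(ℤ/q)ˣ` add up to `-1`. -/
lemma sum_period_out [Fact q.Prime] (hψ : ψ ≠ 1) :
    ∑ c : (ZMod q)ˣ ⧸ Subgroup.zpowers r, period r hr ψ (c.out : (ZMod q)ˣ) = -1 := by
  classical
  have h0 : ∑ u : (ZMod q)ˣ, ψ u = -1 := by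
    have h := AddChar.sum_eq_zero_of_ne_one hψ
    rw [Fintype.sum_eq_add_sum_compl (0 : ZMod q), AddChar.map_zero_eq_one] at h
    rw [neg_eq_of_add_eq_zero_right h]
    refine Finset.sum_nbij (fun u : (ZMod q)ˣ => (u : ZMod q)) ?_ ?_ ?_ (fun _ _ => rfl)
    · simp
    · intro u _ v _ huv
      exact Units.ext huv
    · intro x hx
      exact ⟨Units.mk0 x (by simpa using hx), by simp, rfl⟩
  rw [← h0, ← Finset.sum_fiberwise Finset.univ (QuotientGroup.mk (s := Subgroup.zpowers r))]
  refine Finset.sum_congr rfl fun c _ => ?_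
  refine Finset.sum_bij (fun (s : ZMod p) _ => r ^ s.val * c.out) ?_ ?_ ?_ ?_
  · intro s _
    rw [Finset.mem_filter, mul_comm]
    refine ⟨Finset.mem_univ _, ?_⟩
    conv_rhs => rw [← QuotientGroup.out_eq' c]
    exact QuotientGroup.mk_mul_of_mem _ (pow_mem (Subgroup.mem_zpowers r) _)
  · intro s _ t _ hst
    have h := mul_right_cancel hst
    rw [pow_eq_pow_iff_modEq, hr] at h
    exact ZMod.val_injective p (h.eq_of_lt_of_lt s.val_lt t.val_lt)
  · intro u hu
    have h : c = QuotientGroup.mk u := by simpa [eq_comm] using hu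
    have hmem : (c.out)⁻¹ * u ∈ Subgroup.zpowers r := by
      rw [← QuotientGroup.eq, ← h]
      exact QuotientGroup.out_eq' c
    rw [mem_zpowers_iff_mem_range_orderOf, hr, Finset.mem_image] at hmem
    obtain ⟨n, hn, hnu⟩ := hmem
    refine ⟨(n : ZMod p), Finset.mem_univ _, ?_⟩
    rw [ZMod.val_cast_of_lt (Finset.mem_range.mp hn), hnu, mul_comm, mul_inv_cancel_left]
  · intro s _
    rfl

/-- The products of Gauss periods are not all divisible by `p`. -/
lemma exists_not_isIntegral_period_mul_period_div [Fact p.Prime] [Fact q.Prime] [CharZero F]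
    (hψ : ψ ≠ 1) :
    ∃ i j : ZMod q, ¬ IsIntegral ℤ (period r hr ψ i * period r hr ψ j / p) := by
  by_contra! h
  have hp : (p : F) ≠ 0 := by exact_mod_cast (NeZero.ne p)
  have h1 : IsIntegral ℤ ((p : F)⁻¹) := by
    have hsum : (p : F)⁻¹ = ∑ c : (ZMod q)ˣ ⧸ Subgroup.zpowers r,
        ∑ d : (ZMod q)ˣ ⧸ Subgroup.zpowers r, period r hr ψ (c.out : (ZMod q)ˣ) *
          period r hr ψ (d.out : (ZMod q)ˣ) / p := by
      simp_rw [← Finset.sum_div, ← Finset.mul_sum, sum_period_out r hr ψ hψ, ← Finset.sum_mul,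
        sum_period_out r hr ψ hψ]
      simp
    rw [hsum]
    exact IsIntegral.sum _ fun c _ => IsIntegral.sum _ fun d _ => h _ _
  have h2 : IsIntegral ℤ ((p : ℚ)⁻¹) := by
    rw [← isIntegral_algebraMap_iff (algebraMap ℚ F).injective]
    simpa using h1
  obtain ⟨n, hn⟩ := IsIntegrallyClosed.isIntegral_iff.mp h2
  have hp' : (p : ℚ) ≠ 0 := by exact_mod_cast (NeZero.ne p)
  have hn' : n * (p : ℤ) = 1 := by
    have : (n : ℚ) * p = 1 := by
      rw [show (n : ℚ) = (p : ℚ)⁻¹ from hn, inv_mul_cancel₀ hp']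
    exact_mod_cast this
  have hu : IsUnit (p : ℤ) := IsUnit.of_mul_eq_one n (by rw [mul_comm]; exact hn')
  exact (Nat.prime_iff_prime_int.mp (Fact.out : p.Prime)).not_isUnit hu

end GalindoNatale

/-! ### The Hopf algebra `B_{p,q}(ζ)` -/

namespace GalindoNatale

open Coalgebra Bialgebra HopfAlgebra Multiplicative

section

variable {p q : ℕ} [NeZero p] (r : (ZMod q)ˣ) (hr : orderOf r = p)

/-- The conjugate `σ^s a^i σ^{-s}`. -/
def aConj (i : ZMod q) (s : ZMod p) : G r hr :=
  (SemidirectProduct.inl (action r hr (ofAdd s) (ofAdd i)), 1)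

/-- The conjugate `τ^s b^i τ^{-s}`. -/
def bConj (i : ZMod q) (s : ZMod p) : G r hr :=
  (1, SemidirectProduct.inl (action r hr (ofAdd s) (ofAdd i)))

lemma inr_ofAdd_one_pow (n : ℕ) :
    (SemidirectProduct.inr (ofAdd (1 : ZMod p)) : Factor r hr) ^ n =
      SemidirectProduct.inr (ofAdd (n : ZMod p)) := by
  rw [← map_pow, ← ofAdd_nsmul, nsmul_one]

lemma σ_pow_eq (n : ℕ) : σ r hr ^ n = (SemidirectProduct.inr (ofAdd (n : ZMod p)), 1) := by
  rw [σ, Prod.pow_mk, inr_ofAdd_one_pow, one_pow]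

lemma τ_pow_eq (n : ℕ) : τ r hr ^ n = (1, SemidirectProduct.inr (ofAdd (n : ZMod p))) := by
  rw [τ, Prod.pow_mk, inr_ofAdd_one_pow, one_pow]

lemma inr_mul_inl_action (i : ZMod q) (s v : ZMod p) :
    (SemidirectProduct.inr (ofAdd v) : Factor r hr) *
        SemidirectProduct.inl (action r hr (ofAdd s) (ofAdd i)) =
      SemidirectProduct.inl (action r hr (ofAdd (s + v)) (ofAdd i)) *
        SemidirectProduct.inr (ofAdd v) := by
  rw [add_comm s v, ← action_action, SemidirectProduct.inl_aut (φ := action r hr) (ofAdd v), map_inv,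
    inv_mul_cancel_right]

lemma σ_pow_mul_aConj (i : ZMod q) (s v : ZMod p) :
    σ r hr ^ v.val * aConj r hr i s = aConj r hr i (s + v) * σ r hr ^ v.val := by
  rw [σ_pow_eq, ZMod.natCast_zmod_val, aConj, aConj, Prod.mk_mul_mk, inr_mul_inl_action]
  simp

lemma τ_pow_mul_bConj (i : ZMod q) (s v : ZMod p) :
    τ r hr ^ v.val * bConj r hr i s = bConj r hr i (s + v) * τ r hr ^ v.val := by
  rw [τ_pow_eq, ZMod.natCast_zmod_val, bConj, bConj, Prod.mk_mul_mk, inr_mul_inl_action]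
  simp

lemma commute_aConj_τ (i : ZMod q) (s : ZMod p) : Commute (aConj r hr i s) (τ r hr) := by
  simp [Commute, SemiconjBy, aConj, τ]

lemma commute_bConj_σ (i : ZMod q) (s : ZMod p) : Commute (bConj r hr i s) (σ r hr) := by
  simp [Commute, SemiconjBy, bConj, σ]

instance [Fact q.Prime] : Finite (G r hr) := by
  have : Finite (Factor r hr) := Finite.of_equiv _ SemidirectProduct.equivProd.symm
  infer_instance

end

section

variable {K F : Type*} [Field K] [Field F] [Algebra K F] {p q : ℕ} [NeZero p] (r : (ZMod q)ˣ)
  (hr : orderOf r = p) {ζ : K}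

variable (ζ) in
/-- The coefficients `σ^s a^i σ^{-s} f_{t-s}` of a `p`-dimensional comodule over `B_{p,q}(ζ)`, where
`f_n` is the idempotent on which `τ` acts by `ζ^n`. -/
noncomputable def aCoeff (i : ZMod q) (s t : ZMod p) : MonoidAlgebra K (G r hr) :=
  MonoidAlgebra.of K _ (aConj r hr i s) * idem p ζ (MonoidAlgebra.of K _ (τ r hr)) (t - s).val

variable (ζ) in
/-- The coefficients `τ^t b^i τ^{-t} e_{s-t}` of a `p`-dimensional comodule over `B_{p,q}(ζ)`, where
`e_n` is the idempotent on which `σ` acts by `ζ^n`. -/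
noncomputable def bCoeff (i : ZMod q) (s t : ZMod p) : MonoidAlgebra K (G r hr) :=
  MonoidAlgebra.of K _ (bConj r hr i t) * idem p ζ (MonoidAlgebra.of K _ (σ r hr)) (s - t).val

lemma comul_aCoeff (hζ : IsPrimitiveRoot ζ p) (i : ZMod q) (s t : ZMod p) :
    comul (R := K) (A := B r hr hζ) (aCoeff r hr ζ i s t) =
      ∑ k, (aCoeff r hr ζ i s k : B r hr hζ) ⊗ₜ[K] (aCoeff r hr ζ i k t : B r hr hζ) := by
  have h := comulTwist_mul_idem_left hζ (x := MonoidAlgebra.of K (G r hr) (τ r hr))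
    (y := MonoidAlgebra.of K (G r hr) (σ r hr))
    (by rw [← map_pow, τ_pow, map_one]) (by rw [← map_pow, σ_pow, map_one])
    ((commute_σ_τ r hr).symm.map (MonoidAlgebra.of K (G r hr)))
    (MonoidAlgebra.isGroupLikeElem_of (τ r hr)) (MonoidAlgebra.isGroupLikeElem_of (σ r hr))
    (g := fun s => MonoidAlgebra.of K _ (aConj r hr i s))
    (fun s => (commute_aConj_τ r hr i s).map (MonoidAlgebra.of K (G r hr)))
    (fun s => MonoidAlgebra.isGroupLikeElem_of _)
    (fun s v => by simp_rw [← map_pow, ← map_mul, σ_pow_mul_aConj]) s (t - s)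
  refine h.trans (Fintype.sum_equiv (Equiv.addLeft s) _ _ fun v => ?_)
  simp only [aCoeff, Equiv.coe_addLeft, add_sub_cancel_left, sub_sub]

lemma comul_bCoeff (hζ : IsPrimitiveRoot ζ p) (i : ZMod q) (s t : ZMod p) :
    comul (R := K) (A := B r hr hζ) (bCoeff r hr ζ i s t) =
      ∑ k, (bCoeff r hr ζ i s k : B r hr hζ) ⊗ₜ[K] (bCoeff r hr ζ i k t : B r hr hζ) := by
  have h := comulTwist_mul_idem_right hζ (x := MonoidAlgebra.of K (G r hr) (τ r hr))
    (y := MonoidAlgebra.of K (G r hr) (σ r hr))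
    (by rw [← map_pow, τ_pow, map_one]) (by rw [← map_pow, σ_pow, map_one])
    ((commute_σ_τ r hr).symm.map (MonoidAlgebra.of K (G r hr)))
    (MonoidAlgebra.isGroupLikeElem_of (τ r hr)) (MonoidAlgebra.isGroupLikeElem_of (σ r hr))
    (g := fun s => MonoidAlgebra.of K _ (bConj r hr i s))
    (fun s => (commute_bConj_σ r hr i s).map (MonoidAlgebra.of K (G r hr)))
    (fun s => MonoidAlgebra.isGroupLikeElem_of _)
    (fun s v => by simp_rw [← map_pow, ← map_mul, τ_pow_mul_bConj]) t (s - t)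
  refine h.trans (Fintype.sum_equiv (Equiv.addLeft t) _ _ fun v => ?_)
  simp only [bCoeff, Equiv.coe_addLeft, add_sub_cancel_left, sub_sub]

lemma sum_idem_sub (hζ : IsPrimitiveRoot ζ p) {A : Type*} [Ring A] [Algebra K A] (x : A)
    (s : ZMod p) : ∑ t : ZMod p, idem p ζ x (t - s).val = 1 :=
  (Equiv.sum_comp (Equiv.subRight s) fun n : ZMod p => idem p ζ x n.val).trans
    (sum_idem_zmod hζ x)

lemma counit_aCoeff (hζ : IsPrimitiveRoot ζ p) (i : ZMod q) (s t : ZMod p) :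
    counit (R := K) (aCoeff r hr ζ i s t) = if s = t then 1 else 0 := by
  rw [aCoeff, Bialgebra.counit_mul, counit_idem hζ (MonoidAlgebra.isGroupLikeElem_of _),
    (MonoidAlgebra.isGroupLikeElem_of _).counit_eq_one, one_mul]
  simp only [sub_eq_zero, eq_comm]

lemma counit_bCoeff (hζ : IsPrimitiveRoot ζ p) (i : ZMod q) (s t : ZMod p) :
    counit (R := K) (bCoeff r hr ζ i s t) = if s = t then 1 else 0 := by
  rw [bCoeff, Bialgebra.counit_mul, counit_idem hζ (MonoidAlgebra.isGroupLikeElem_of _),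
    (MonoidAlgebra.isGroupLikeElem_of _).counit_eq_one, one_mul]
  simp only [sub_eq_zero]

lemma sum_aCoeff (hζ : IsPrimitiveRoot ζ p) (i : ZMod q) : ∑ s, ∑ t, aCoeff r hr ζ i s t =
    ∑ s, MonoidAlgebra.of K _ (aConj r hr i s) := by
  refine Finset.sum_congr rfl fun s _ => ?_
  simp_rw [aCoeff, ← Finset.mul_sum, sum_idem_sub hζ, mul_one]

lemma sum_bCoeff (hζ : IsPrimitiveRoot ζ p) (i : ZMod q) : ∑ s, ∑ t, bCoeff r hr ζ i s t =
    ∑ s, MonoidAlgebra.of K _ (bConj r hr i s) := by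
  rw [Finset.sum_comm]
  refine Finset.sum_congr rfl fun s _ => ?_
  simp_rw [bCoeff, ← Finset.mul_sum, sum_idem_sub hζ, mul_one]

variable (ψ : AddChar (ZMod q) F)

open scoped Kronecker in
/-- The exterior tensor square of the induced representation of `ℤ_q ⋊ ℤ_p`, a representation
of `G` of dimension `p^2`. -/
noncomputable def tensorRep : G r hr →* Matrix (ZMod p × ZMod p) (ZMod p × ZMod p) F where
  toFun g := inducedRep r hr ψ g.1 ⊗ₖ inducedRep r hr ψ g.2
  map_one' := by simp
  map_mul' g h := by simp [Matrix.mul_kronecker_mul]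

variable (K) in
/-- The linear extension of `tensorRep` to the group algebra. -/
noncomputable def algRep :
    MonoidAlgebra K (G r hr) →ₐ[K] Matrix (ZMod p × ZMod p) (ZMod p × ZMod p) F :=
  MonoidAlgebra.lift K _ _ (tensorRep r hr ψ)

lemma algRep_of (g : G r hr) : algRep K r hr ψ (MonoidAlgebra.of K _ g) = tensorRep r hr ψ g :=
  MonoidAlgebra.lift_of ..

lemma trace_tensorRep (g : G r hr) : (tensorRep r hr ψ g).trace =
    (inducedRep r hr ψ g.1).trace * (inducedRep r hr ψ g.2).trace :=
  Matrix.trace_kronecker _ _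

open scoped Kronecker in
lemma algRep_sum_aConj_mul_sum_bConj (i j : ZMod q) :
    algRep K r hr ψ ((∑ s, MonoidAlgebra.of K _ (aConj r hr i s)) *
      ∑ s, MonoidAlgebra.of K _ (bConj r hr j s)) =
      algebraMap F _ (period r hr ψ i * period r hr ψ j) := by
  have ha : algRep K r hr ψ (∑ s, MonoidAlgebra.of K _ (aConj r hr i s)) =
      period r hr ψ i • 1 := by
    have h : algRep K r hr ψ (∑ s, MonoidAlgebra.of K _ (aConj r hr i s)) =
        (∑ s : ZMod p, inducedRep r hr ψ
          (SemidirectProduct.inl (action r hr (ofAdd s) (ofAdd i)))) ⊗ₖ 1 := by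
      simp_rw [map_sum, algRep_of]
      ext
      simp [tensorRep, aConj, Matrix.sum_apply, Finset.sum_mul]
    rw [h, sum_inducedRep_inl, Matrix.smul_kronecker, Matrix.one_kronecker_one]
  have hb : algRep K r hr ψ (∑ s, MonoidAlgebra.of K _ (bConj r hr j s)) =
      period r hr ψ j • 1 := by
    have h : algRep K r hr ψ (∑ s, MonoidAlgebra.of K _ (bConj r hr j s)) =
        1 ⊗ₖ (∑ s : ZMod p, inducedRep r hr ψ
          (SemidirectProduct.inl (action r hr (ofAdd s) (ofAdd j)))) := by
      simp_rw [map_sum, algRep_of]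
      ext
      simp [tensorRep, bConj, Matrix.sum_apply, Finset.mul_sum]
    rw [h, sum_inducedRep_inl, Matrix.kronecker_smul, Matrix.one_kronecker_one]
  rw [map_mul, ha, hb, Algebra.algebraMap_eq_smul_one, smul_mul_smul_comm, one_mul]

/-- The character of `tensorRep` takes the same value on all products of coefficients of the two
comodules: since it vanishes off the normal subgroup generated by `a` and `b`, each of the two
idempotents contributes the factor `1/p`. -/
lemma trace_algRep_aCoeff_mul_bCoeff (i j : ZMod q) (s t k l : ZMod p) :
    (algRep K r hr ψ (aCoeff r hr ζ i s t * bCoeff r hr ζ j k l)).trace =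
      period r hr ψ i * period r hr ψ j / p ^ 2 := by
  have h (u v : ZMod p) : (algRep K r hr ψ (MonoidAlgebra.of K _ (aConj r hr i s) *
      MonoidAlgebra.of K _ (τ r hr) ^ u.val * (MonoidAlgebra.of K _ (bConj r hr j l) *
        MonoidAlgebra.of K _ (σ r hr) ^ v.val))).trace =
      if u = 0 then if v = 0 then period r hr ψ i * period r hr ψ j else 0 else 0 := by
    rw [← map_pow, ← map_pow, ← map_mul, ← map_mul, ← map_mul, algRep_of, trace_tensorRep,
      trace_inducedRep, trace_inducedRep, σ_pow_eq, τ_pow_eq, ZMod.natCast_zmod_val,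
      ZMod.natCast_zmod_val]
    simp only [aConj, bConj, Prod.fst_mul, Prod.snd_mul, SemidirectProduct.mul_right,
      SemidirectProduct.mul_left, SemidirectProduct.right_inl, SemidirectProduct.right_inr,
      SemidirectProduct.left_inl, SemidirectProduct.left_inr, one_mul, mul_one, map_one,
      ofAdd_eq_one, period_action]
    split_ifs with h1 h2
    · subst h2
      rw [ofAdd_zero, map_one, MulAut.one_apply, period_action]
    all_goals simp
  rw [aCoeff, bCoeff, idem_val, idem_val]
  simp only [mul_smul_comm, smul_mul_assoc, Finset.mul_sum, Finset.sum_mul, map_smul, map_sum,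
    Matrix.trace_smul, Matrix.trace_sum, h]
  simp only [smul_ite, smul_zero, Finset.sum_ite_eq', Finset.mem_univ, if_true, ZMod.val_zero,
    zero_mul, pow_zero, one_smul]
  rw [Algebra.smul_def, Algebra.smul_def, map_inv₀, map_natCast]
  ring

/-- No base change of `B_{p,q}(ζ)` to an algebraically closed field of characteristic zero has an
integral form: the contraction of the comultiplication of the product of the characters of the two
comodules with the character of `tensorRep` would be an integral element which acts on `tensorRep`
as the square of a quotient of a product of two Gauss periods by `p`. -/
theorem not_isIntegralForm [Fact p.Prime] [Fact q.Prime] [IsAlgClosed F] [CharZero F]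
    (hζ : IsPrimitiveRoot ζ p) (hψ : ψ ≠ 1)
    (Y : Subalgebra (integralClosure ℤ F) (F ⊗[K] B r hr hζ)) : ¬ IsIntegralForm Y := by
  intro hY
  obtain ⟨i, j, hij⟩ := exists_not_isIntegral_period_mul_period_div r hr ψ hψ
  refine hij ?_
  let ρ₀ : B r hr hζ →ₐ[K] Matrix (ZMod p × ZMod p) (ZMod p × ZMod p) F := algRep K r hr ψ
  let ρ : F ⊗[K] B r hr hζ →ₐ[F] Matrix (ZMod p × ZMod p) (ZMod p × ZMod p) F :=
    Algebra.TensorProduct.lift (Algebra.ofId F _) ρ₀ fun _ _ => Algebra.commutes _ _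
  have hρ (h : B r hr hζ) : ρ (1 ⊗ₜ h) = ρ₀ h := by
    exact (Algebra.TensorProduct.lift_tmul ..).trans (by rw [map_one, one_mul])
  let a (s t : ZMod p) : B r hr hζ := aCoeff r hr ζ i s t
  let b (s t : ZMod p) : B r hr hζ := bCoeff r hr ζ j s t
  have hε (h : B r hr hζ) : counit (R := F) ((1 : F) ⊗ₜ[K] h) =
      algebraMap K F (counit (R := K) h) := by
    rw [TensorProduct.counit_tmul, CommSemiring.counit_apply, Algebra.algebraMap_eq_smul_one]
  have hmem := hY.smul_sum_mul_sum_mem (C := fun s t => (1 : F) ⊗ₜ[K] a s t)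
    (D := fun s t => (1 : F) ⊗ₜ[K] b s t)
    (χ := Matrix.traceLinearMap (ZMod p × ZMod p) F F ∘ₗ ρ.toLinearMap)
    (γ := period r hr ψ i * period r hr ψ j / p ^ 2)
    (fun s t => comul_one_tmul_eq_sum (comul_aCoeff r hr hζ i s t))
    (fun s t => by
      rw [hε, show counit (R := K) (a s t) = _ from counit_aCoeff r hr hζ i s t]
      split_ifs <;> simp)
    (fun s t => comul_one_tmul_eq_sum (comul_bCoeff r hr hζ j s t))
    (fun s t => by
      rw [hε, show counit (R := K) (b s t) = _ from counit_bCoeff r hr hζ j s t]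
      split_ifs <;> simp)
    (fun y hy => hY.isIntegral_trace ρ hy)
    (fun s t k l => by
      rw [Algebra.TensorProduct.tmul_mul_tmul, one_mul, LinearMap.comp_apply,
        AlgHom.toLinearMap_apply, hρ]
      exact trace_algRep_aCoeff_mul_bCoeff r hr ψ i j s t k l)
  have hscalar : ρ ((period r hr ψ i * period r hr ψ j / (p : F) ^ 2) •
      ((∑ s, ∑ t, (1 : F) ⊗ₜ[K] a s t) * ∑ s, ∑ t, (1 : F) ⊗ₜ[K] b s t)) =
      algebraMap F _ ((period r hr ψ i * period r hr ψ j / p) ^ 2) := by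
    -- the idempotents of `τ` and of `σ` add up to `1`, which leaves the sums of the conjugates of
    -- `a^i` and of `b^j`, on which the representation takes scalar values
    simp_rw [← TensorProduct.tmul_sum]
    rw [Algebra.TensorProduct.tmul_mul_tmul, one_mul, map_smul, hρ]
    have h : ρ₀ ((∑ s, ∑ t, a s t) * ∑ s, ∑ t, b s t) =
        algebraMap F _ (period r hr ψ i * period r hr ψ j) := by
      rw [show ∑ s, ∑ t, a s t = _ from sum_aCoeff r hr hζ i,
        show ∑ s, ∑ t, b s t = _ from sum_bCoeff r hr hζ j]
      exact algRep_sum_aConj_mul_sum_bConj r hr ψ i j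
    rw [h, Algebra.smul_def, ← map_mul]
    congr 1
    ring
  exact (hY.isIntegral_of_map_eq_algebraMap ρ hmem hscalar).of_pow two_pos

end

end GalindoNatale

theorem mainTheorem2 (p q : ℕ) [Fact p.Prime] [Fact q.Prime] (hpq : p ∣ q - 1)
    (r : (ZMod q)ˣ) (hr : orderOf r = p) (ζ : ℂ) (hζ : IsPrimitiveRoot ζ p) :
    IsSemisimpleRing
        (ℂ ⊗[ℚ⟮ζ⟯] GalindoNatale.B r hr (GalindoNatale.isPrimitiveRoot_gen hζ)) ∧
      ∀ (L : Type*) [Field L] [NumberField L] [Algebra L ℂ],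
        ¬ ∃ X : Submodule (NumberField.RingOfIntegers L)
            (ℂ ⊗[ℚ⟮ζ⟯] GalindoNatale.B r hr (GalindoNatale.isPrimitiveRoot_gen hζ)),
          IsHopfOrder (NumberField.RingOfIntegers L) ℂ X := by
  refine ⟨MonoidAlgebra.isSemisimpleRing_baseChange ℚ⟮ζ⟯ ℂ (GalindoNatale.G r hr), ?_⟩
  rintro L _ _ _ ⟨X, hX⟩
  obtain ⟨Y, hY⟩ := hX.exists_isIntegralForm
  exact GalindoNatale.not_isIntegralForm r hr ZMod.stdAddChar
    (GalindoNatale.isPrimitiveRoot_gen hζ)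
    (by simpa using ZMod.isPrimitive_stdAddChar q one_ne_zero) Y hY
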